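/- Let $\mathbb D$ be the open unit disc. An approach function is a non-decreasing continuous function $h:[0,1]\to[0,1]$ with $h(0)=0$. For such $h$ (and, by the same formulas, for $h(t)=ct$ with any $c>0$), put $\Delta^h=\{x+iy:|x|\le h(y),\ 0<y<1\}$ and, for $\varphi\in[0,2\pi]$, $\Omega^h(\varphi)=f_\varphi(\Delta^h)$, where $f_\varphi(z)=e^{i\varphi}(i-z)/(i+z)$ maps the upper half-plane onto $\mathbb D$. For $u$ continuous on $\mathbb D$ and $0<r<1$ write $M_r(|u|)=\max_{0\le\theta\le2\pi}|u(re^{i\theta})|$, and let $\log^+x=\max(\log x,0)$ for $x>0$, $\log^+0=0$. Consider the condition $$\lim_{z\in\Omega^h(\varphi),\ z\to e^{i\varphi}}u(z)=0\qquad\text{for every }\varphi\in[0,2\pi].\tag{1}$$ (a) If $h$ is an approach function with $h(t)=o(t^3)$ as $t\to0+$, then there exists a real-valued harmonic function $u\not\equiv0$ on $\mathbb D$ satisfying (1) such that $M_r(|u|)=O((1-r)^{-2})$ as $r\to1-$. (b) If $1<\gamma\le3$, $h(t)=t^\gamma$ and $\varepsilon>0$, then there exists a real-valued harmonic function $u\not\equiv0$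 on $\mathbb D$ satisfying (1) such that $\log^+M_r(|u|)\le\varepsilon(1-r)^{-1}$ for all $r\in(0,1)$. (c) If $c>0$, $h(t)=ct$ and $\varepsilon>0$, then there exists a real-valued harmonic function $u\not\equiv0$ on $\mathbb D$ satisfying (1) such that $\log^+M_r(|u|)\le\varepsilon(1-r)^{-\pi/(2\arctan(1/c))}$ for all $r\in(0,1)$. (d) If $0<\gamma<1$ and $h(t)=t^\gamma$, then there exist a constant $k=k(\gamma)>0$ and a real-valued harmonic function $u\not\equiv0$ on $\mathbb D$ satisfying (1) such that $\log^+\log^+M_r(|u|)\le k(1-r)^{\gamma-1}$ for all $r\in(0,1)$. -/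

import Mathlib

open Set Filter Topology Asymptotics

/-- An approach function: a non-decreasing continuous function from `[0,1]` to `[0,1]` vanishing
at `0` (only the values on `[0,1]` matter). -/
structure IsApproachFunction (h : ℝ → ℝ) : Prop where
  monotoneOn : MonotoneOn h (Icc 0 1)
  continuousOn : ContinuousOn h (Icc 0 1)
  mapsTo : MapsTo h (Icc 0 1) (Icc 0 1)
  map_zero : h 0 = 0

/-- The model approach domain `Δ^h = {x + iy : |x| ≤ h(y), 0 < y < 1}` in the upper half-plane. -/
def modelDomain (h : ℝ → ℝ) : Set ℂ :=
  {z | |z.re| ≤ h z.im ∧ 0 < z.im ∧ z.im < 1}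

/-- The conformal map `f_φ(z) = e^{iφ} (i - z) / (i + z)` of the upper half-plane onto the
unit disc; it sends `0` to `e^{iφ}`. -/
noncomputable def discMap (φ : ℝ) (z : ℂ) : ℂ :=
  Complex.exp (φ * Complex.I) * ((Complex.I - z) / (Complex.I + z))

/-- The approach domain `Ω^h(φ) = f_φ(Δ^h)` at the boundary point `e^{iφ}`. -/
def approachDomain (h : ℝ → ℝ) (φ : ℝ) : Set ℂ :=
  discMap φ '' modelDomain h

/-- `u(z) → 0` as `z → e^{iφ}` inside `Ω^h(φ)`, for every `φ ∈ [0, 2π]`. -/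
def HasZeroLimitsAlong (h : ℝ → ℝ) (u : ℂ → ℝ) : Prop :=
  ∀ φ ∈ Icc (0 : ℝ) (2 * Real.pi),
    Tendsto u (𝓝[approachDomain h φ] (Complex.exp (φ * Complex.I))) (𝓝 0)

/-- `M_r(v) = max_{0 ≤ θ ≤ 2π} v(r e^{iθ})`; the maximum is attained when `v` is continuous
on the unit disc and `0 < r < 1`. -/
noncomputable def circleMax (v : ℂ → ℝ) (r : ℝ) : ℝ :=
  sSup ((fun θ : ℝ => v (r * Complex.exp (θ * Complex.I))) '' Icc 0 (2 * Real.pi))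

/-- `u` is harmonic in the open unit disc and not identically zero there. -/
def IsNonzeroHarmonicOnDisc (u : ℂ → ℝ) : Prop :=
  InnerProductSpace.HarmonicOnNhd u (Metric.ball 0 1) ∧ ∃ z ∈ Metric.ball (0 : ℂ) 1, u z ≠ 0

/-! Only one boundary point needs work. Let w be the upper half-plane coordinate of z and ζ = 1/w,
so that z = 1 corresponds to ζ = ∞ and the disc to the lower half-plane. For E entire and real on
the real axis, u = δ Im E(ζ) is harmonic in the disc and vanishes continuously at every boundary
point except 1. At 1, condition (1) follows if Im E tends to zero at infinity within the inverted
approach domain, and the growth of u is that of E, since |ζ| ≤ 2/(1 - r).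

If h(t) = o(t³), E(ζ) = ζ² suffices. Otherwise E is a Mittag-Leffler type integral of e^p p⁻³ /
(ψ(p) - ζ) over a line Re p = n, taken far enough to the right that Re ψ > Re ζ on it. Cauchy's
theorem makes the value independent of n, hence E is entire with |E(ζ)| ≤ C exp(ν(Re ζ)), where Re
ψ(p) ≥ x + 1 once Re p ≥ ν(x). For ζ off the tract, the image under ψ of a fixed half-plane, the
line can stay fixed, and E is bounded and tends to zero there (`exists_entire_small_off_tract`).

What remains is to choose ψ so that the tract avoids the inverted approach domain while ν grows as
slowly as possible: K p^α for sectors, K (p + p^s) for γ > 1, K (log p)^b for γ < 1. -/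

/-! ### Mittag-Leffler type contour integrals -/

/-- The integrand `e^p p⁻³ / (ψ(p) - ζ)` of the Mittag-Leffler type integrals. -/
noncomputable def mlKernel (ψ : ℂ → ℂ) (ζ p : ℂ) : ℂ :=
  Complex.exp p / p ^ 3 / (ψ p - ζ)

/-- The integral of `e^p p⁻³ / (ψ(p) - ζ)` over the vertical line `Re p = n`. -/
noncomputable def mlIntegral (ψ : ℂ → ℂ) (n : ℝ) (ζ : ℂ) : ℂ :=
  ∫ t : ℝ, mlKernel ψ ζ (n + t * Complex.I)

/-- The cube in the kernel pays for a weak separation: a gap of only c/|p| costs one power of p, and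
the remaining |p|⁻² is still integrable along vertical lines. -/
lemma mlKernel_norm_le {ψ : ℂ → ℂ} {ζ p : ℂ} {c : ℝ} (hp : 1 ≤ p.re) (hc : 0 < c)
    (h : c / ‖p‖ ≤ ‖ψ p - ζ‖) :
    ‖mlKernel ψ ζ p‖ ≤ Real.exp p.re * c⁻¹ * (1 + p.im ^ 2)⁻¹ := by
  have hp0 : 0 < ‖p‖ := lt_of_lt_of_le (by linarith) (Complex.re_le_norm p)
  have hsq : 1 + p.im ^ 2 ≤ ‖p‖ ^ 2 := by
    rw [← Complex.normSq_eq_norm_sq, Complex.normSq_apply]; nlinarith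
  have h0 : 0 < 1 + p.im ^ 2 := by positivity
  rw [mlKernel, norm_div, norm_div, norm_pow, Complex.norm_exp]
  have hpos : 0 < c / ‖p‖ := by positivity
  calc Real.exp p.re / ‖p‖ ^ 3 / ‖ψ p - ζ‖ ≤ Real.exp p.re / ‖p‖ ^ 3 / (c / ‖p‖) := by gcongr
    _ = Real.exp p.re * c⁻¹ * (‖p‖ ^ 2)⁻¹ := by field_simp
    _ ≤ _ := by gcongr

lemma mlKernel_continuous_line {ψ : ℂ → ℂ} {ζ : ℂ} {n₀ n : ℝ} (h1 : 1 ≤ n₀) (hn : n₀ ≤ n)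
    (hψ : DifferentiableOn ℂ ψ {p | n₀ ≤ p.re})
    (h : ∀ t : ℝ, ψ (n + t * Complex.I) - ζ ≠ 0) :
    Continuous fun t : ℝ => mlKernel ψ ζ (n + t * Complex.I) := by
  have hl : Continuous fun t : ℝ => (n + t * Complex.I : ℂ) := by fun_prop
  have hψl : Continuous fun t : ℝ => ψ (n + t * Complex.I) :=
    hψ.continuousOn.comp_continuous hl (by intro t; simpa using hn)
  unfold mlKernel
  refine Continuous.div (Continuous.div (by fun_prop) (by fun_prop) ?_)
    (hψl.sub continuous_const) h
  intro t ht
  have := congrArg Complex.re (pow_eq_zero_iff (three_ne_zero) |>.1 ht)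
  simp at this
  linarith

lemma mlKernel_integrable_line {ψ : ℂ → ℂ} {ζ : ℂ} {n₀ n c : ℝ} (h1 : 1 ≤ n₀) (hn : n₀ ≤ n)
    (hψ : DifferentiableOn ℂ ψ {p | n₀ ≤ p.re}) (hc : 0 < c)
    (h : ∀ p : ℂ, p.re = n → c / ‖p‖ ≤ ‖ψ p - ζ‖) :
    MeasureTheory.Integrable fun t : ℝ => mlKernel ψ ζ (n + t * Complex.I) := by
  refine (integrable_inv_one_add_sq.const_mul (Real.exp n * c⁻¹)).mono'
    (mlKernel_continuous_line h1 hn hψ ?_).aestronglyMeasurable (.of_forall fun t => ?_)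
  · intro t ht
    have := h (n + t * Complex.I) (by simp)
    rw [ht, norm_zero] at this
    have h0 : 0 < ‖(n + t * Complex.I : ℂ)‖ :=
      lt_of_lt_of_le (by simp; linarith) (Complex.re_le_norm _)
    have : 0 < c / ‖(n + t * Complex.I : ℂ)‖ := by positivity
    linarith
  · simpa using mlKernel_norm_le (p := n + t * Complex.I) (by simp; linarith) hc
      (h _ (by simp))

lemma mlIntegral_norm_le {ψ : ℂ → ℂ} {ζ : ℂ} {n c : ℝ} (hn : 1 ≤ n) (hc : 0 < c)
    (h : ∀ p : ℂ, p.re = n → c / ‖p‖ ≤ ‖ψ p - ζ‖) :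
    ‖mlIntegral ψ n ζ‖ ≤ Real.exp n * c⁻¹ * Real.pi := by
  rw [← integral_univ_inv_one_add_sq, ← MeasureTheory.integral_const_mul]
  refine MeasureTheory.norm_integral_le_of_norm_le (integrable_inv_one_add_sq.const_mul _)
    (.of_forall fun t => ?_)
  simpa using mlKernel_norm_le (p := n + t * Complex.I) (by simp; linarith) hc (h _ (by simp))

/-- Cauchy's theorem on the rectangles [n, m] × [-T, T]; the horizontal sides contribute O(1/(1 +
T²)). -/
lemma mlIntegral_eq_of_le {ψ : ℂ → ℂ} {ζ : ℂ} {n₀ n m c : ℝ} (h1 : 1 ≤ n₀) (hn : n₀ ≤ n)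
    (hm : n ≤ m) (hψ : DifferentiableOn ℂ ψ {p | n₀ ≤ p.re}) (hc : 0 < c)
    (h : ∀ p : ℂ, n ≤ p.re → c / ‖p‖ ≤ ‖ψ p - ζ‖) :
    mlIntegral ψ n ζ = mlIntegral ψ m ζ := by
  have hi : ∀ k, n ≤ k → Tendsto (fun T : ℝ => ∫ t in -T..T, mlKernel ψ ζ (k + t * Complex.I))
      atTop (𝓝 (mlIntegral ψ k ζ)) := fun k hk =>
    MeasureTheory.intervalIntegral_tendsto_integral
      (mlKernel_integrable_line h1 (hn.trans hk) hψ hc fun p hp => h p (by linarith))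
      tendsto_neg_atTop_atBot tendsto_id
  have hdiff : DifferentiableOn ℂ (mlKernel ψ ζ) {p | n ≤ p.re} := by
    unfold mlKernel
    refine DifferentiableOn.div (DifferentiableOn.div (by fun_prop) (by fun_prop) ?_)
      ((hψ.mono fun p (hp : n ≤ p.re) => hn.trans hp).sub_const _) ?_
    · intro p hp h0
      have h0 := congrArg Complex.re (pow_eq_zero_iff (three_ne_zero) |>.1 h0)
      have hp : n ≤ p.re := hp
      simp at h0
      linarith
    · intro p hp h0
      have hp' : n ≤ p.re := hp
      have := h p hp
      rw [h0, norm_zero] at this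
      have h0 : 0 < ‖p‖ := lt_of_lt_of_le (by linarith) (Complex.re_le_norm _)
      have : 0 < c / ‖p‖ := by positivity
      linarith
  have hhor : ∀ T : ℝ, ∀ s : ℝ, s ^ 2 = T ^ 2 →
      ‖∫ x in n..m, mlKernel ψ ζ (x + s * Complex.I)‖ ≤
        Real.exp m * c⁻¹ * (1 + T ^ 2)⁻¹ * |m - n| := by
    intro T s hs
    refine intervalIntegral.norm_integral_le_of_norm_le_const fun x hx => ?_
    rw [uIoc_of_le hm] at hx
    refine (mlKernel_norm_le (p := x + s * Complex.I) (by simp; linarith [hx.1]) hc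
      (h _ (by simpa using hx.1.le))).trans ?_
    simp only [Complex.add_re, Complex.ofReal_re, Complex.mul_re, Complex.I_re, mul_zero,
      Complex.ofReal_im, Complex.I_im, mul_one, sub_self, add_zero, Complex.add_im,
      Complex.mul_im, zero_add, hs]
    have := hx.2
    gcongr
  have hz : Tendsto (fun T : ℝ => Real.exp m * c⁻¹ * (1 + T ^ 2)⁻¹ * |m - n|) atTop (𝓝 0) := by
    have : Tendsto (fun T : ℝ => (1 + T ^ 2)⁻¹) atTop (𝓝 0) :=
      tendsto_inv_atTop_zero.comp
        (tendsto_atTop_add_const_left _ _ (tendsto_pow_atTop two_ne_zero))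
    simpa using (this.const_mul (Real.exp m * c⁻¹)).mul_const |m - n|
  have hbot := squeeze_zero_norm (fun T => hhor T (-T) (by ring)) hz
  have htop := squeeze_zero_norm (fun T => hhor T T rfl) hz
  have hrect : ∀ T : ℝ, (∫ x in n..m, mlKernel ψ ζ (x + (-T : ℝ) * Complex.I)) -
      (∫ x in n..m, mlKernel ψ ζ (x + T * Complex.I)) +
      Complex.I • (∫ t in -T..T, mlKernel ψ ζ (m + t * Complex.I)) -
      Complex.I • (∫ t in -T..T, mlKernel ψ ζ (n + t * Complex.I)) = 0 := by
    intro T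
    have := Complex.integral_boundary_rect_eq_zero_of_differentiableOn (mlKernel ψ ζ)
      ⟨n, -T⟩ ⟨m, T⟩ (hdiff.mono ?_)
    · simpa using this
    · rintro p ⟨hp, -⟩
      rw [mem_preimage] at hp
      simp only [uIcc_of_le hm] at hp
      exact hp.1
  have hlim := ((hbot.sub htop).add ((hi m hm).const_smul Complex.I)).sub
    ((hi n le_rfl).const_smul Complex.I)
  have h0 := tendsto_nhds_unique hlim (by simp only [hrect]; exact tendsto_const_nhds)
  simp only [sub_self, zero_add, smul_eq_mul, ← mul_sub, mul_eq_zero, Complex.I_ne_zero,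
    false_or] at h0
  exact (sub_eq_zero.1 h0).symm

lemma one_div_norm_le_norm_sub {ψ : ℂ → ℂ} {ζ p : ℂ} (hp : 1 ≤ p.re)
    (h : 1 ≤ (ψ p).re - ζ.re) : 1 / ‖p‖ ≤ ‖ψ p - ζ‖ := by
  have h1 : 1 ≤ ‖p‖ := hp.trans (Complex.re_le_norm p)
  have h2 : 1 ≤ ‖ψ p - ζ‖ := le_trans (by simpa using h) (Complex.re_le_norm _)
  exact ((div_le_one (by linarith)).2 h1).trans h2

/-- Differentiation under the integral sign. A margin of 2 at ζ₀ leaves a margin of 1 on the unit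
ball, so the extra factor 1/(ψ - ζ) in the derivative has norm at most 1 and the same dominating
function serves. -/
lemma mlIntegral_differentiableAt {ψ : ℂ → ℂ} {ζ₀ : ℂ} {n₀ n : ℝ} (h1 : 1 ≤ n₀) (hn : n₀ ≤ n)
    (hψ : DifferentiableOn ℂ ψ {p | n₀ ≤ p.re})
    (h : ∀ p : ℂ, p.re = n → ζ₀.re + 2 ≤ (ψ p).re) :
    DifferentiableAt ℂ (mlIntegral ψ n) ζ₀ := by
  have hsep : ∀ ζ ∈ Metric.ball ζ₀ 1, ∀ p : ℂ, p.re = n → 1 ≤ (ψ p).re - ζ.re := by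
    intro ζ hζ p hp
    have h2 := h p hp
    have h3 : ‖ζ - ζ₀‖ < 1 := by simpa [dist_eq_norm] using hζ
    have h4 := (Complex.re_le_norm (ζ - ζ₀)).trans_lt h3
    rw [Complex.sub_re] at h4
    linarith
  have hb : ∀ ζ ∈ Metric.ball ζ₀ 1, ∀ p : ℂ, p.re = n → 1 / ‖p‖ ≤ ‖ψ p - ζ‖ := fun ζ hζ p hp =>
    one_div_norm_le_norm_sub (by linarith) (hsep ζ hζ p hp)
  have hne : ∀ ζ ∈ Metric.ball ζ₀ 1, ∀ t : ℝ, ψ (n + t * Complex.I) - ζ ≠ 0 := by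
    intro ζ hζ t h0
    have := hsep ζ hζ (n + t * Complex.I) (by simp)
    rw [← Complex.sub_re, h0, Complex.zero_re] at this
    linarith
  have h0 : ζ₀ ∈ Metric.ball ζ₀ (1 : ℝ) := Metric.mem_ball_self one_pos
  have hl : Continuous fun t : ℝ => (n + t * Complex.I : ℂ) := by fun_prop
  have hψl : Continuous fun t : ℝ => ψ (n + t * Complex.I) :=
    hψ.continuousOn.comp_continuous hl (by intro t; simpa using hn)
  refine (hasDerivAt_integral_of_dominated_loc_of_deriv_le (μ := MeasureTheory.volume)
    (F := fun ζ (t : ℝ) => mlKernel ψ ζ (n + t * Complex.I))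
    (F' := fun ζ (t : ℝ) => mlKernel ψ ζ (n + t * Complex.I) / (ψ (n + t * Complex.I) - ζ))
    (bound := fun t => Real.exp n * 1⁻¹ * (1 + t ^ 2)⁻¹)
    (Metric.ball_mem_nhds ζ₀ one_pos) ?_ ?_ ?_ ?_ ?_ ?_).2.differentiableAt
  · filter_upwards [Metric.ball_mem_nhds ζ₀ one_pos] with ζ hζ
    exact (mlKernel_continuous_line h1 hn hψ (hne ζ hζ)).aestronglyMeasurable
  · exact mlKernel_integrable_line h1 hn hψ one_pos (hb ζ₀ h0)
  · exact ((mlKernel_continuous_line h1 hn hψ (hne ζ₀ h0)).div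
      (hψl.sub continuous_const)
      (hne ζ₀ h0)).aestronglyMeasurable
  · refine .of_forall fun t ζ hζ => ?_
    rw [norm_div]
    have h2 : 1 ≤ ‖ψ (n + t * Complex.I) - ζ‖ :=
      le_trans (by simpa using hsep ζ hζ (n + t * Complex.I) (by simp)) (Complex.re_le_norm _)
    refine (div_le_self (norm_nonneg _) h2).trans ?_
    simpa using mlKernel_norm_le (p := n + t * Complex.I) (by simp; linarith) one_pos
      (hb ζ hζ _ (by simp))
  · exact integrable_inv_one_add_sq.const_mul _
  · refine .of_forall fun t ζ hζ => ?_
    have h3 := hne ζ hζ t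
    have := ((hasDerivAt_const ζ (Complex.exp (n + t * Complex.I) / (n + t * Complex.I) ^ 3)).div
      ((hasDerivAt_id ζ).const_sub (ψ (n + t * Complex.I))) h3)
    refine this.congr_deriv ?_
    simp only [mlKernel, id]
    field_simp
    ring

lemma mlIntegral_conj {ψ : ℂ → ℂ} {n : ℝ}
    (hψ : ∀ p : ℂ, p.re = n → ψ (starRingEnd ℂ p) = starRingEnd ℂ (ψ p)) (ζ : ℂ) :
    mlIntegral ψ n (starRingEnd ℂ ζ) = starRingEnd ℂ (mlIntegral ψ n ζ) := by
  unfold mlIntegral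
  rw [← integral_conj, ← MeasureTheory.integral_neg_eq_self]
  congr 1
  ext t
  have h := hψ (n + t * Complex.I) (by simp)
  simp only [map_add, Complex.conj_ofReal, map_mul, Complex.conj_I, mul_neg] at h
  simp [mlKernel, ← Complex.exp_conj, h]

/-- Away from the image of `ψ`, the integral tends to zero at infinity. -/
lemma mlIntegral_tendsto_zero {ψ : ℂ → ℂ} {n c : ℝ} (hn : 1 ≤ n) (hc : 0 < c)
    (hψ : DifferentiableOn ℂ ψ {p | n ≤ p.re}) {S : Set ℂ}
    (h : ∀ ζ ∈ S, ∀ p : ℂ, p.re = n → c / ‖p‖ ≤ ‖ψ p - ζ‖) :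
    Tendsto (mlIntegral ψ n) (Bornology.cobounded ℂ ⊓ 𝓟 S) (𝓝 0) := by
  have hS : ∀ᶠ ζ in Bornology.cobounded ℂ ⊓ 𝓟 S, ζ ∈ S := mem_inf_of_right (mem_principal_self S)
  have : (0 : ℂ) = ∫ t : ℝ, (0 : ℂ) := by simp
  rw [this]
  have hcg : (Bornology.cobounded ℂ).IsCountablyGenerated := by
    rw [← comap_norm_atTop]; infer_instance
  refine MeasureTheory.tendsto_integral_filter_of_dominated_convergence
    (fun t => Real.exp n * c⁻¹ * (1 + t ^ 2)⁻¹) ?_ ?_ (integrable_inv_one_add_sq.const_mul _) ?_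
  · filter_upwards [hS] with ζ hζ
    exact (mlKernel_integrable_line hn le_rfl hψ hc (h ζ hζ)).aestronglyMeasurable
  · filter_upwards [hS] with ζ hζ
    refine .of_forall fun t => ?_
    simpa using mlKernel_norm_le (p := n + t * Complex.I) (by simp; linarith) hc
      (h ζ hζ _ (by simp))
  · refine .of_forall fun t => ?_
    have h1 : Tendsto (fun ζ : ℂ => (ψ (n + t * Complex.I) - ζ)⁻¹) (Bornology.cobounded ℂ)
        (𝓝 0) := by
      refine tendsto_inv₀_cobounded.comp ?_
      exact tendsto_const_sub_cobounded _
    have h2 := (h1.mono_left (inf_le_left (b := 𝓟 S))).const_mul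
      (Complex.exp (n + t * Complex.I) / (n + t * Complex.I) ^ 3)
    rw [mul_zero] at h2
    exact h2

/-! ### Inverse Laplace transform of p⁻³ -/

lemma norm_sq_mul_exp_neg (n w t : ℝ) :
    ‖(t : ℂ) ^ 2 * Complex.exp (-((n + w * Complex.I) * t))‖ = t ^ 2 * Real.exp (-(n * t)) := by
  rw [norm_mul, norm_pow, Complex.norm_exp, Complex.norm_real, Real.norm_eq_abs, sq_abs]
  simp

lemma integrableOn_sq_mul_exp_neg {n : ℝ} (hn : 0 < n) (w : ℝ) :
    MeasureTheory.IntegrableOn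
      (fun t : ℝ => (t : ℂ) ^ 2 * Complex.exp (-((n + w * Complex.I) * t))) (Ioi 0) := by
  have h := integrableOn_rpow_mul_exp_neg_mul_rpow (p := 1) (s := 2) (b := n) (by norm_num)
    one_pos hn
  refine MeasureTheory.Integrable.mono' h (by fun_prop) (.of_forall fun t => ?_)
  rw [norm_sq_mul_exp_neg]
  simp

lemma tendsto_pow_mul_cexp_neg {n : ℝ} (hn : 1 ≤ n) (w : ℝ) (k : ℕ) :
    Tendsto (fun t : ℝ => (t : ℂ) ^ k * Complex.exp (-((n + w * Complex.I) * t))) atTop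
      (𝓝 0) := by
  refine squeeze_zero_norm' ?_ (Real.tendsto_pow_mul_exp_neg_atTop_nhds_zero k)
  filter_upwards [eventually_ge_atTop 0] with t ht
  rw [norm_mul, norm_pow, Complex.norm_exp, Complex.norm_real, Real.norm_eq_abs, abs_of_nonneg ht]
  have : (-((n + w * Complex.I) * t : ℂ)).re ≤ -t := by
    simp only [Complex.neg_re, Complex.mul_re, Complex.add_re, Complex.ofReal_re, Complex.I_re,
      Complex.ofReal_im, Complex.add_im, Complex.mul_im, Complex.I_im]
    nlinarith
  gcongr

lemma integral_sq_mul_exp_neg {n : ℝ} (hn : 1 ≤ n) (w : ℝ) :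
    ∫ t in Ioi (0 : ℝ), (t : ℂ) ^ 2 * Complex.exp (-((n + w * Complex.I) * t)) =
      2 / (n + w * Complex.I) ^ 3 := by
  set r : ℂ := n + w * Complex.I with hr
  have hr0 : r ≠ 0 := fun h => by
    have := congrArg Complex.re h
    simp [hr] at this
    linarith
  -- Antiderivative from two integrations by parts. The powers 1 and 0 are kept explicit so that
  -- every term has the shape of `tendsto_pow_mul_cexp_neg`.
  have hderiv : ∀ x ∈ Ici (0 : ℝ), HasDerivAt
      (fun t : ℝ => -(((t : ℂ) ^ 2 * Complex.exp (-(r * t))) / r +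
        2 * ((t : ℂ) ^ 1 * Complex.exp (-(r * t))) / r ^ 2 +
        2 * ((t : ℂ) ^ 0 * Complex.exp (-(r * t))) / r ^ 3))
      ((x : ℂ) ^ 2 * Complex.exp (-(r * x))) x := by
    intro x _
    have h1 : HasDerivAt (fun z : ℂ => z) 1 (x : ℂ) := hasDerivAt_id _
    have he : HasDerivAt (fun z : ℂ => Complex.exp (-(r * z)))
        (Complex.exp (-(r * x)) * -(r * 1)) (x : ℂ) := ((h1.const_mul r).neg).cexp
    have := ((((h1.pow 2).mul he).div_const r).add
      ((((h1.pow 1).mul he).const_mul 2).div_const (r ^ 2))).add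
      ((((h1.pow 0).mul he).const_mul 2).div_const (r ^ 3)) |>.neg.comp_ofReal
    refine this.congr_deriv ?_
    simp only [Pi.pow_apply]
    push_cast
    field_simp
    ring
  have hlim := ((((tendsto_pow_mul_cexp_neg hn w 2).div_const r).add
      (((tendsto_pow_mul_cexp_neg hn w 1).const_mul 2).div_const (r ^ 2))).add
      (((tendsto_pow_mul_cexp_neg hn w 0).const_mul 2).div_const (r ^ 3))).neg
  rw [MeasureTheory.integral_Ioi_of_hasDerivAt_of_tendsto' hderiv
    (integrableOn_sq_mul_exp_neg (by linarith) w) hlim]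
  simp

lemma line_re_norm {n : ℝ} (hn : 1 ≤ n) (t : ℝ) : 0 < ‖(n + t * Complex.I : ℂ)‖ :=
  lt_of_lt_of_le (by simp; linarith) (Complex.re_le_norm _)

lemma norm_exp_div_cube_le {n : ℝ} (hn : 1 ≤ n) (t : ℝ) :
    ‖Complex.exp (n + t * Complex.I) / (n + t * Complex.I) ^ 3‖ ≤
      Real.exp n * 1⁻¹ * (1 + t ^ 2)⁻¹ := by
  -- For constant ψ = 1 and ζ = 0 the kernel reduces to e^p / p³.
  have h := mlKernel_norm_le (ψ := fun _ => 1) (ζ := 0) (p := n + t * Complex.I) (c := 1)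
    (by simpa using hn) one_pos ?_
  · simpa [mlKernel] using h
  · rw [sub_zero, norm_one, div_le_one (line_re_norm hn t)]
    exact le_trans (by simpa using hn) (Complex.re_le_norm _)

/-- Up to a constant factor this is the inverse Laplace transform of 2/p³ at time 1. The Fourier
transform of t² e^{-nt} on t > 0 is 2/(n + 2πiw)³, which is integrable, so Fourier inversion at t =
1 recovers e^{-n} ≠ 0. -/
lemma integral_exp_div_cube_ne_zero {n : ℝ} (hn : 1 ≤ n) :
    ∫ t : ℝ, Complex.exp (n + t * Complex.I) / (n + t * Complex.I) ^ 3 ≠ 0 := by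
  set g : ℝ → ℂ := (Ioi (0 : ℝ)).indicator fun t => (t : ℂ) ^ 2 * Complex.exp (-(n * t)) with hg
  have hne : ∀ t : ℝ, (n + t * Complex.I : ℂ) ^ 3 ≠ 0 := fun t =>
    pow_ne_zero _ (norm_pos_iff.1 (line_re_norm hn t))
  have hgi : MeasureTheory.Integrable g := by
    rw [hg, MeasureTheory.integrable_indicator_iff measurableSet_Ioi]
    simpa using integrableOn_sq_mul_exp_neg (n := n) (by linarith) 0
  have hF : ∀ w : ℝ, FourierTransform.fourier g w =
      2 / (n + (2 * Real.pi * w : ℝ) * Complex.I) ^ 3 := by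
    intro w
    rw [Real.fourier_real_eq_integral_exp_smul, ← integral_sq_mul_exp_neg hn,
      ← MeasureTheory.integral_indicator measurableSet_Ioi]
    congr 1
    ext t
    by_cases ht : t ∈ Ioi (0 : ℝ)
    · simp only [hg, indicator_of_mem ht, smul_eq_mul]
      rw [mul_left_comm, ← Complex.exp_add]
      congr 2
      push_cast
      ring
    · simp [hg, indicator_of_notMem ht]
  have hline : MeasureTheory.Integrable fun t : ℝ => (2 : ℂ) / (n + t * Complex.I) ^ 3 := by
    have hc : Continuous fun t : ℝ => (2 : ℂ) / (n + t * Complex.I) ^ 3 :=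
      continuous_const.div (by fun_prop) hne
    refine (integrable_inv_one_add_sq.const_mul 2).mono' hc.aestronglyMeasurable
      (.of_forall fun t => ?_)
    have h := norm_exp_div_cube_le hn t
    rw [norm_div, Complex.norm_exp] at h
    simp only [Complex.add_re, Complex.ofReal_re, Complex.mul_re, Complex.I_re, mul_zero,
      Complex.ofReal_im, Complex.I_im, mul_one, sub_self, add_zero, inv_one] at h
    rw [div_eq_mul_inv] at h
    rw [norm_div, div_eq_mul_inv, Complex.norm_ofNat]
    have := le_of_mul_le_mul_left h (Real.exp_pos n)
    linarith
  have hFi : MeasureTheory.Integrable (FourierTransform.fourier g) := by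
    rw [show FourierTransform.fourier g = _ from funext hF]
    exact hline.comp_mul_left' (by positivity)
  have hcont : ContinuousAt g 1 := by
    have : g =ᶠ[𝓝 1] fun t => (t : ℂ) ^ 2 * Complex.exp (-(n * t)) := by
      filter_upwards [Ioi_mem_nhds one_pos] with t ht
      exact indicator_of_mem ht _
    exact ContinuousAt.congr (by fun_prop) this.symm
  have hinv := hgi.fourierInv_fourier_eq hFi hcont
  rw [Real.fourierInv_eq'] at hinv
  have hscale := MeasureTheory.Measure.integral_comp_mul_left
    (fun t : ℝ => Complex.exp (t * Complex.I) * (2 / (n + t * Complex.I) ^ 3)) (2 * Real.pi)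
  have hg1 : g 1 ≠ 0 := by
    rw [hg, indicator_of_mem (by simp)]
    simp
  intro h0
  apply hg1
  rw [← hinv]
  have hJ : ∫ t : ℝ, Complex.exp (t * Complex.I) * (2 / (n + t * Complex.I) ^ 3) = 0 := by
    have h2 : ∀ t : ℝ, Complex.exp (t * Complex.I) * (2 / (n + t * Complex.I) ^ 3) =
        (2 * Complex.exp (-n)) *
          (Complex.exp (n + t * Complex.I) / (n + t * Complex.I) ^ 3) := by
      intro t
      rw [Complex.exp_add, Complex.exp_neg]
      field_simp
    simp_rw [h2]
    rw [MeasureTheory.integral_const_mul, h0, mul_zero]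
  rw [hJ, smul_zero] at hscale
  rw [← hscale]
  congr 1
  ext w
  rw [hF, smul_eq_mul]
  simp

/-! ### Entire functions small off a tract -/

/-- Leading behaviour on the negative axis, used to rule out a constant E. The factor x/(ψ + x)
tends to 1 and has norm at most 1 because Re ψ ≥ 0. -/
lemma tendsto_mul_mlIntegral_neg {ψ : ℂ → ℂ} {n : ℝ} (hn : 1 ≤ n)
    (hψ : DifferentiableOn ℂ ψ {p | n ≤ p.re}) (hre : ∀ p : ℂ, p.re = n → 0 ≤ (ψ p).re) :
    Tendsto (fun x : ℝ => (x : ℂ) * mlIntegral ψ n (-x)) atTop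
      (𝓝 (∫ t : ℝ, Complex.exp (n + t * Complex.I) / (n + t * Complex.I) ^ 3)) := by
  simp only [mlIntegral, ← MeasureTheory.integral_const_mul]
  have hle : ∀ x : ℝ, 0 < x → ∀ t : ℝ, x ≤ ‖ψ (n + t * Complex.I) - (-x : ℂ)‖ := by
    intro x hx t
    refine le_trans ?_ (Complex.re_le_norm _)
    have := hre (n + t * Complex.I) (by simp)
    simpa using this
  refine MeasureTheory.tendsto_integral_filter_of_dominated_convergence
    (fun t => Real.exp n * 1⁻¹ * (1 + t ^ 2)⁻¹) ?_ ?_ (integrable_inv_one_add_sq.const_mul _) ?_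
  · filter_upwards [eventually_gt_atTop 0] with x hx
    refine (continuous_const.mul (mlKernel_continuous_line hn le_rfl hψ ?_)).aestronglyMeasurable
    intro t h0
    have := hle x hx t
    rw [h0, norm_zero] at this
    linarith
  · filter_upwards [eventually_gt_atTop 0] with x hx
    refine .of_forall fun t => le_trans ?_ (norm_exp_div_cube_le hn t)
    have h1 := hle x hx t
    rw [mlKernel, norm_mul, norm_div _ (ψ _ - _), Complex.norm_real, Real.norm_eq_abs,
      abs_of_pos hx, mul_div_left_comm]
    exact mul_le_of_le_one_right (norm_nonneg _) ((div_le_one (by linarith)).2 h1)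
  · refine .of_forall fun t => ?_
    have h1 : Tendsto (fun x : ℝ => (x : ℂ)⁻¹) atTop (𝓝 0) := by
      have := (Complex.continuous_ofReal.tendsto 0).comp tendsto_inv_atTop_zero
      simpa [Function.comp_def] using this
    have h2 := ((h1.const_mul (ψ (n + t * Complex.I))).add_const 1).inv₀ (by simp)
    have h3 := h2.const_mul (Complex.exp (n + t * Complex.I) / (n + t * Complex.I) ^ 3)
    simp only [mul_zero, zero_add, inv_one, mul_one] at h3
    refine h3.congr' ?_
    filter_upwards [eventually_gt_atTop 0] with x hx
    have hx0 : (x : ℂ) ≠ 0 := by exact_mod_cast hx.ne'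
    have h4 : ψ (n + t * Complex.I) + x ≠ 0 := by
      intro h0
      have := hle x hx t
      rw [sub_neg_eq_add, h0, norm_zero] at this
      linarith
    rw [mlKernel, sub_neg_eq_add, show ψ (n + t * Complex.I) * (x : ℂ)⁻¹ + 1 =
      (ψ (n + t * Complex.I) + x) / x by field_simp, inv_div]
    ring

lemma mlIntegral_eq {ψ : ℂ → ℂ} {ζ : ℂ} {n₀ n m c d : ℝ} (h1 : 1 ≤ n₀) (hn : n₀ ≤ n)
    (hm : n₀ ≤ m) (hψ : DifferentiableOn ℂ ψ {p | n₀ ≤ p.re}) (hc : 0 < c) (hd : 0 < d)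
    (hcn : ∀ p : ℂ, n ≤ p.re → c / ‖p‖ ≤ ‖ψ p - ζ‖)
    (hdm : ∀ p : ℂ, m ≤ p.re → d / ‖p‖ ≤ ‖ψ p - ζ‖) :
    mlIntegral ψ n ζ = mlIntegral ψ m ζ := by
  rcases le_total n m with h | h
  · exact mlIntegral_eq_of_le h1 hn h hψ hc hcn
  · exact (mlIntegral_eq_of_le h1 hm h hψ hd hdm).symm

/-- An entire function which is real on the real axis and not constant takes a nonreal value in
the lower half-plane. -/
lemma exists_im_ne_zero {E : ℂ → ℂ} (hE : Differentiable ℂ E) {a b : ℂ} (hab : E a ≠ E b) :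
    ∃ ζ : ℂ, ζ.im < 0 ∧ (E ζ).im ≠ 0 := by
  by_contra! h
  have hopen : IsOpen {ζ : ℂ | ζ.im < 0} := isOpen_lt Complex.continuous_im continuous_const
  have hA : AnalyticOnNhd ℂ E univ := fun z _ => hE.analyticAt z
  -- Open mapping theorem: the image of the lower half-plane is open, so it cannot lie in the real
  -- axis.
  rcases hA.is_constant_or_isOpen isPreconnected_univ with ⟨w, hw⟩ | h'
  · exact hab (by rw [hw a trivial, hw b trivial])
  · have hO := h' _ (subset_univ _) hopen
    have hsub : E '' {ζ : ℂ | ζ.im < 0} ⊆ {z | z.im = 0} := by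
      rintro _ ⟨ζ, hζ, rfl⟩
      exact h ζ hζ
    have hmem : E (-Complex.I) ∈ E '' {ζ : ℂ | ζ.im < 0} := ⟨-Complex.I, by simp, rfl⟩
    obtain ⟨ε, hε, hball⟩ := Metric.isOpen_iff.1 hO _ hmem
    have h0 := hsub hmem
    have h1 : E (-Complex.I) + (ε / 2 : ℝ) * Complex.I ∈ Metric.ball (E (-Complex.I)) ε := by
      simp only [Metric.mem_ball, dist_eq_norm, add_sub_cancel_left, norm_mul, Complex.norm_real,
        Complex.norm_I, mul_one, Real.norm_eq_abs]
      rw [abs_of_pos (by linarith)]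
      linarith
    have h2 := hsub (hball h1)
    simp only [mem_ofPred_eq] at h0 h2
    simp [h0] at h2
    linarith

/-- Entire functions of Mittag-Leffler type which are small outside of the image of a half-plane
under `ψ`. -/
theorem exists_entire_small_off_tract {ψ : ℂ → ℂ} {n₀ : ℝ} {ν : ℝ → ℝ} (h1 : 1 ≤ n₀)
    (hψ : DifferentiableOn ℂ ψ {p | n₀ ≤ p.re})
    (hconj : ∀ p : ℂ, n₀ ≤ p.re → ψ (starRingEnd ℂ p) = starRingEnd ℂ (ψ p))
    (hre : ∀ p : ℂ, n₀ ≤ p.re → 0 ≤ (ψ p).re)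
    (hν : ∀ x, 0 ≤ x → n₀ ≤ ν x)
    (hνψ : ∀ x, 0 ≤ x → ∀ p : ℂ, ν x ≤ p.re → x + 1 ≤ (ψ p).re) :
    ∃ E : ℂ → ℂ, Differentiable ℂ E ∧ (∀ x : ℝ, (E x).im = 0) ∧
      (∃ ζ : ℂ, ζ.im < 0 ∧ (E ζ).im ≠ 0) ∧
      (∃ C, 0 < C ∧ ∀ ζ, ‖E ζ‖ ≤ C * Real.exp (ν (max ζ.re 0))) ∧
      ∀ (S : Set ℂ) (c : ℝ), 0 < c →
        (∀ ζ ∈ S, ∀ p : ℂ, n₀ ≤ p.re → c / ‖p‖ ≤ ‖ψ p - ζ‖) →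
        Tendsto E (Bornology.cobounded ℂ ⊓ 𝓟 S) (𝓝 0) ∧ ∃ C, ∀ ζ ∈ S, ‖E ζ‖ ≤ C := by
  -- The contour moves with ζ so as to keep ζ strictly to the left of its image; `hEeq` allows any
  -- other admissible contour.
  set E : ℂ → ℂ := fun ζ => mlIntegral ψ (ν (max ζ.re 0)) ζ with hE
  have hν0 : ∀ ζ : ℂ, n₀ ≤ ν (max ζ.re 0) := fun ζ => hν _ (le_max_right _ _)
  have hsep : ∀ (ζ : ℂ) (x : ℝ), 0 ≤ x → ζ.re ≤ x → ∀ p : ℂ, ν x ≤ p.re →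
      1 / ‖p‖ ≤ ‖ψ p - ζ‖ := by
    intro ζ x hx hζ p hp
    refine one_div_norm_le_norm_sub (h1.trans ((hν x hx).trans hp)) ?_
    have := hνψ x hx p hp
    linarith
  have hEeq : ∀ (ζ : ℂ) (n c : ℝ), n₀ ≤ n → 0 < c →
      (∀ p : ℂ, n ≤ p.re → c / ‖p‖ ≤ ‖ψ p - ζ‖) → E ζ = mlIntegral ψ n ζ :=
    fun ζ n c hn hc h => mlIntegral_eq h1 (hν0 ζ) hn hψ one_pos hc
      (hsep ζ _ (le_max_right _ _) (le_max_left _ _)) h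
  have hdiff : Differentiable ℂ E := by
    intro ζ₀
    set x : ℝ := |ζ₀.re| + 1
    have hx : 0 ≤ x := by positivity
    -- Near ζ₀ a single contour works. The abscissa ν x gives Re ψ ≥ |Re ζ₀| + 2, the margin
    -- required for differentiability.
    have hev : E =ᶠ[𝓝 ζ₀] mlIntegral ψ (ν x) := by
      have : ∀ᶠ ζ : ℂ in 𝓝 ζ₀, ζ.re < x :=
        (Complex.continuous_re.tendsto ζ₀).eventually_lt_const
          (lt_of_le_of_lt (le_abs_self _) (lt_add_one _))
      filter_upwards [this] with ζ hζ
      exact hEeq ζ _ 1 (hν x hx) one_pos (hsep ζ x hx hζ.le)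
    refine (mlIntegral_differentiableAt h1 (hν x hx) hψ fun p hp => ?_).congr_of_eventuallyEq hev
    have := hνψ x hx p hp.ge
    have := le_abs_self ζ₀.re
    simp only [x] at *
    linarith
  have hreal : ∀ x : ℝ, (E x).im = 0 := by
    intro x
    have := mlIntegral_conj (n := ν (max x 0)) (fun p hp =>
      hconj p (by rw [hp]; exact hν0 x)) (x : ℂ)
    rw [Complex.conj_ofReal] at this
    exact Complex.conj_eq_iff_im.1 this.symm
  have hsmall : ∀ (S : Set ℂ) (c : ℝ), 0 < c →
        (∀ ζ ∈ S, ∀ p : ℂ, n₀ ≤ p.re → c / ‖p‖ ≤ ‖ψ p - ζ‖) →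
        Tendsto E (Bornology.cobounded ℂ ⊓ 𝓟 S) (𝓝 0) ∧ ∃ C, ∀ ζ ∈ S, ‖E ζ‖ ≤ C := by
    intro S c hc hS
    -- Off the tract the contour can be pulled back to the fixed line Re p = n₀.
    have heq : ∀ ζ ∈ S, E ζ = mlIntegral ψ n₀ ζ := fun ζ hζ => hEeq ζ n₀ c le_rfl hc (hS ζ hζ)
    refine ⟨?_, Real.exp n₀ * c⁻¹ * Real.pi, fun ζ hζ => ?_⟩
    · refine (mlIntegral_tendsto_zero h1 hc hψ fun ζ hζ p hp => hS ζ hζ p hp.ge).congr' ?_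
      filter_upwards [mem_inf_of_right (mem_principal_self S)] with ζ hζ
      exact (heq ζ hζ).symm
    · rw [heq ζ hζ]
      exact mlIntegral_norm_le h1 hc fun p hp => hS ζ hζ p hp.ge
  -- If E were constant, convergence of x E(-x) would force E = 0, and the limit would vanish,
  -- contrary to `integral_exp_div_cube_ne_zero`.
  have hnonconst : ∃ a b : ℂ, E a ≠ E b := by
    by_contra! hcon
    have hν1 : n₀ ≤ ν 0 := hν 0 le_rfl
    have hJ := tendsto_mul_mlIntegral_neg (h1.trans hν1)
      (hψ.mono fun p (hp : ν 0 ≤ p.re) => hν1.trans hp)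
      (fun p hp => hre p (hν1.trans hp.ge))
    have hE0 : ∀ᶠ x : ℝ in atTop, mlIntegral ψ (ν 0) (-x) = E 0 := by
      filter_upwards [eventually_ge_atTop 0] with x hx
      rw [hcon 0 (-x)]
      simp only [hE]
      rw [max_eq_right (by simpa using hx)]
    have hinv : Tendsto (fun x : ℝ => (x : ℂ)⁻¹) atTop (𝓝 0) := by
      have := (Complex.continuous_ofReal.tendsto 0).comp tendsto_inv_atTop_zero
      simpa [Function.comp_def] using this
    have hmul := hinv.mul hJ
    rw [zero_mul] at hmul
    have hE00 : E 0 = 0 := by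
      refine tendsto_nhds_unique (tendsto_const_nhds.congr' ?_) hmul
      filter_upwards [hE0, eventually_gt_atTop 0] with x hx hx0
      have : (x : ℂ) ≠ 0 := by exact_mod_cast hx0.ne'
      rw [hx]
      field_simp
    refine integral_exp_div_cube_ne_zero (h1.trans hν1) (tendsto_nhds_unique hJ ?_)
    refine tendsto_const_nhds.congr' ?_
    filter_upwards [hE0] with x hx
    rw [hx, hE00, mul_zero]
  obtain ⟨a, b, hab⟩ := hnonconst
  refine ⟨E, hdiff, hreal, exists_im_ne_zero hdiff hab, ⟨1⁻¹ * Real.pi, by positivity, ?_⟩,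
    hsmall⟩
  intro ζ
  have := mlIntegral_norm_le (h1.trans (hν0 ζ)) one_pos (fun p hp =>
    hsep ζ _ (le_max_right _ _) (le_max_left _ _) p hp.ge)
  calc ‖E ζ‖ ≤ _ := this
    _ = _ := by ring

/-! ### Transfer from the lower half-plane to the disc -/

/-- The Möbius map `z ↦ -i (1 + z) / (1 - z)` of the disc onto the lower half-plane, which is
`1 / w` in terms of the upper half-plane coordinate `w`. -/
noncomputable def lowerHalfPlaneMap (z : ℂ) : ℂ := -Complex.I * (1 + z) / (1 - z)

lemma lowerHalfPlaneMap_im_eq_zero {ω : ℂ} (hω : ‖ω‖ = 1) (h1 : ω ≠ 1) :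
    (lowerHalfPlaneMap ω).im = 0 := by
  have h0 : ω ≠ 0 := by rintro rfl; simp at hω
  rw [← Complex.conj_eq_iff_im]
  have hc : starRingEnd ℂ ω = ω⁻¹ := by
    rw [Complex.inv_def, Complex.normSq_eq_norm_sq, hω]; simp
  simp only [lowerHalfPlaneMap, map_div₀, map_mul, map_neg, Complex.conj_I, map_add, map_one,
    map_sub, hc, neg_neg]
  have h2 : 1 - ω ≠ 0 := sub_ne_zero.2 h1.symm
  have h3 : 1 - ω⁻¹ ≠ 0 := by
    rw [sub_ne_zero]
    intro h
    exact h1 (by rw [← inv_inv ω, ← h, inv_one])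
  rw [div_eq_div_iff h3 h2]
  field_simp
  ring

lemma continuousAt_lowerHalfPlaneMap {z : ℂ} (hz : z ≠ 1) : ContinuousAt lowerHalfPlaneMap z :=
  ContinuousAt.div (by fun_prop) (by fun_prop) (sub_ne_zero.2 hz.symm)

lemma lowerHalfPlaneMap_cayley {w : ℂ} (hw : 0 < w.im) :
    lowerHalfPlaneMap ((Complex.I - w) / (Complex.I + w)) = w⁻¹ := by
  have h0 : w ≠ 0 := by rintro rfl; simp at hw
  have h1 : Complex.I + w ≠ 0 := fun h => by
    have := congrArg Complex.im h
    simp at this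
    linarith
  have h2 : 1 - (Complex.I - w) / (Complex.I + w) = 2 * w / (Complex.I + w) := by
    field_simp; ring
  have h3 : 1 + (Complex.I - w) / (Complex.I + w) = 2 * Complex.I / (Complex.I + w) := by
    field_simp; ring
  rw [lowerHalfPlaneMap, h2, h3]
  field_simp
  simp

lemma norm_lowerHalfPlaneMap_le {z : ℂ} (hz : ‖z‖ < 1) :
    ‖lowerHalfPlaneMap z‖ ≤ 2 / (1 - ‖z‖) := by
  have h1 : ‖1 + z‖ ≤ 2 := (norm_add_le _ _).trans (by rw [norm_one]; linarith)
  have h2 : 1 - ‖z‖ ≤ ‖1 - z‖ := by simpa using norm_sub_norm_le 1 z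
  rw [lowerHalfPlaneMap, norm_div, norm_mul, norm_neg, Complex.norm_I, one_mul]
  have : 0 < 1 - ‖z‖ := by linarith
  gcongr

/-- The inverse is w = i(1 - z)/(1 + z), with imaginary part (1 - |z|²)/|1 + z|². -/
lemma le_im_inv_lowerHalfPlaneMap {z : ℂ} (hz : ‖z‖ < 1) :
    (1 - ‖z‖) / 4 ≤ (lowerHalfPlaneMap z)⁻¹.im := by
  have h1 : ‖1 + z‖ ≤ 2 := (norm_add_le _ _).trans (by rw [norm_one]; linarith)
  have h2 : 1 - ‖z‖ ≤ ‖1 + z‖ := by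
    have := norm_sub_norm_le 1 (-z)
    simpa using this
  have hpos : 0 < Complex.normSq (1 + z) := by
    rw [Complex.normSq_eq_norm_sq]
    have : 0 < ‖1 + z‖ := by linarith
    positivity
  have h3 : (lowerHalfPlaneMap z)⁻¹.im = (1 - ‖z‖ ^ 2) / Complex.normSq (1 + z) := by
    have : (lowerHalfPlaneMap z)⁻¹ = Complex.I * ((1 - z) / (1 + z)) := by
      have hI : (-Complex.I)⁻¹ = Complex.I := by simp
      rw [lowerHalfPlaneMap, inv_div, div_eq_mul_inv, mul_inv, hI]
      ring
    rw [this, Complex.I_mul_im, Complex.div_re, ← Complex.normSq_eq_norm_sq,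
      ← add_div]
    congr 1
    simp [Complex.normSq_apply]
    ring
  rw [h3, div_le_div_iff₀ (by norm_num) hpos, Complex.normSq_eq_norm_sq]
  have h4 : ‖1 + z‖ ^ 2 ≤ 4 := by nlinarith [norm_nonneg (1 + z)]
  have := norm_nonneg z
  nlinarith

lemma isNonzeroHarmonicOnDisc_of_entire {E : ℂ → ℂ} (hE : Differentiable ℂ E)
    (hne : ∃ ζ : ℂ, ζ.im < 0 ∧ (E ζ).im ≠ 0) {δ : ℝ} (hδ : 0 < δ) :
    IsNonzeroHarmonicOnDisc fun z => δ * (E (lowerHalfPlaneMap z)).im := by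
  constructor
  · intro z hz
    have hz1 : z ≠ 1 := by rintro rfl; simp at hz
    have hl : AnalyticAt ℂ lowerHalfPlaneMap z := by
      have h1 : (1 : ℂ) - z ≠ 0 := sub_ne_zero.2 hz1.symm
      unfold lowerHalfPlaneMap
      fun_prop (disch := assumption)
    have hA : AnalyticAt ℂ (fun z => (δ : ℂ) * E (lowerHalfPlaneMap z)) z :=
      analyticAt_const.mul ((hE.analyticAt _).comp hl)
    have := hA.harmonicAt_im
    simpa [Complex.mul_im] using this
  · obtain ⟨ζ, hζ, h0⟩ := hne
    have h1 : ζ - Complex.I ≠ 0 := fun h => by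
      have := congrArg Complex.im h
      simp at this
      linarith
    -- The preimage of ζ under `lowerHalfPlaneMap`.
    refine ⟨(ζ + Complex.I) / (ζ - Complex.I), ?_, ?_⟩
    · rw [mem_ball_zero_iff, norm_div, div_lt_one (norm_pos_iff.2 h1)]
      refine lt_of_pow_lt_pow_left₀ 2 (norm_nonneg _) ?_
      simp only [← Complex.normSq_eq_norm_sq, Complex.normSq_apply, Complex.add_re,
        Complex.add_im, Complex.sub_re, Complex.sub_im, Complex.I_re, Complex.I_im]
      nlinarith
    · have h2 : lowerHalfPlaneMap ((ζ + Complex.I) / (ζ - Complex.I)) = ζ := by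
        have h3 : 1 + (ζ + Complex.I) / (ζ - Complex.I) = 2 * ζ / (ζ - Complex.I) := by
          field_simp; ring
        have h4 : 1 - (ζ + Complex.I) / (ζ - Complex.I) =
            -(2 * Complex.I) / (ζ - Complex.I) := by
          field_simp; ring
        rw [lowerHalfPlaneMap, h3, h4]
        field_simp
      simp only [h2]
      exact mul_ne_zero hδ.ne' h0

/-- At e^{iφ} ≠ 1 the unrestricted limit is zero, since `lowerHalfPlaneMap` is continuous there with
a real value. At e^{iφ} = 1 the approach domain pulls back to `modelDomain h`, and `hlim` applies.
-/
lemma hasZeroLimitsAlong_of_entire {E : ℂ → ℂ} (hE : Differentiable ℂ E)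
    (hreal : ∀ x : ℝ, (E x).im = 0) {h : ℝ → ℝ} (δ : ℝ)
    (hlim : Tendsto (fun w : ℂ => (E w⁻¹).im) (𝓝[modelDomain h] 0) (𝓝 0)) :
    HasZeroLimitsAlong h fun z => δ * (E (lowerHalfPlaneMap z)).im := by
  intro φ _
  set ω := Complex.exp (φ * Complex.I) with hω
  rw [← mul_zero δ]
  refine Tendsto.const_mul δ ?_
  by_cases h1 : ω = 1
  · have hmem : ∀ z ∈ approachDomain h φ, (lowerHalfPlaneMap z)⁻¹ ∈ modelDomain h := by
      rintro _ ⟨w, hw, rfl⟩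
      rw [discMap, ← hω, h1, one_mul, lowerHalfPlaneMap_cayley hw.2.1, inv_inv]
      exact hw
    have hcont : Tendsto (fun z => (lowerHalfPlaneMap z)⁻¹) (𝓝 1) (𝓝 0) := by
      have : ContinuousAt (fun z : ℂ => (1 - z) / (-Complex.I * (1 + z))) 1 :=
        ContinuousAt.div (by fun_prop) (by fun_prop) (by norm_num)
      have h2 := this.tendsto
      simp only [sub_self, zero_div] at h2
      exact h2.congr fun z => by rw [lowerHalfPlaneMap, inv_div]
    have h3 : Tendsto (fun z => (lowerHalfPlaneMap z)⁻¹) (𝓝[approachDomain h φ] 1)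
        (𝓝[modelDomain h] 0) :=
      tendsto_nhdsWithin_iff.2 ⟨hcont.mono_left nhdsWithin_le_nhds,
        eventually_nhdsWithin_of_forall hmem⟩
    rw [h1]
    have := hlim.comp h3
    simpa [Function.comp_def] using this
  · have hn : ‖ω‖ = 1 := Complex.norm_exp_ofReal_mul_I φ
    have hc : ContinuousAt (fun z => (E (lowerHalfPlaneMap z)).im) ω :=
      Complex.continuous_im.continuousAt.comp
        (hE.continuous.continuousAt.comp (continuousAt_lowerHalfPlaneMap h1))
    have h2 : (E (lowerHalfPlaneMap ω)).im = 0 := by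
      have h3 : lowerHalfPlaneMap ω = ((lowerHalfPlaneMap ω).re : ℂ) :=
        Complex.ext (by simp) (by simpa using lowerHalfPlaneMap_im_eq_zero hn h1)
      rw [h3]
      exact hreal _
    have h4 := hc.tendsto
    rw [h2] at h4
    exact h4.mono_left nhdsWithin_le_nhds

lemma circleMax_abs_nonneg (u : ℂ → ℝ) (r : ℝ) : 0 ≤ circleMax (fun z => |u z|) r :=
  Real.sSup_nonneg (by rintro _ ⟨θ, -, rfl⟩; exact abs_nonneg _)

lemma circleMax_abs_le {u : ℂ → ℝ} {r B : ℝ} (hr : 0 ≤ r) (h : ∀ z : ℂ, ‖z‖ = r → |u z| ≤ B) :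
    circleMax (fun z => |u z|) r ≤ B := by
  refine csSup_le ((nonempty_Icc.2 (by positivity)).image _) ?_
  rintro _ ⟨θ, -, rfl⟩
  refine h _ ?_
  rw [norm_mul, Complex.norm_exp_ofReal_mul_I, Complex.norm_real, mul_one, Real.norm_eq_abs,
    abs_of_nonneg hr]

lemma posLog_le_of_le_exp {x y : ℝ} (hx : 0 ≤ x) (hy : 0 ≤ y) (h : x ≤ Real.exp y) :
    Real.posLog x ≤ y := by
  refine (Real.posLog_le_posLog hx h).trans ?_
  refine max_le hy ?_
  rw [Real.log_exp]

/-- From limits at infinity of `E` off a tract to limits of `E(1/w)` in the approach domain. -/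
lemma tendsto_im_comp_inv {E : ℂ → ℂ} {h : ℝ → ℝ} {S : Set ℂ}
    (hS : ∀ w ∈ modelDomain h, w⁻¹ ∈ S)
    (hE : Tendsto E (Bornology.cobounded ℂ ⊓ 𝓟 S) (𝓝 0)) :
    Tendsto (fun w : ℂ => (E w⁻¹).im) (𝓝[modelDomain h] 0) (𝓝 0) := by
  have hinv : Tendsto (fun w : ℂ => w⁻¹) (𝓝[modelDomain h] 0)
      (Bornology.cobounded ℂ ⊓ 𝓟 S) := by
    refine tendsto_inf.2 ⟨?_, tendsto_principal.2 (eventually_nhdsWithin_of_forall hS)⟩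
    refine tendsto_inv₀_nhdsNE_zero.mono_left (nhdsWithin_mono _ ?_)
    rintro w hw rfl
    simpa using hw.2.1
  have := (Complex.continuous_im.tendsto 0).comp (hE.comp hinv)
  simpa [Function.comp_def] using this

/-! ### Domains thinner than t³: the quadratic function -/

theorem exists_harmonic_of_littleO_cube {h : ℝ → ℝ}
    (ho : h =o[𝓝[>] 0] (fun t : ℝ => t ^ 3)) :
    ∃ u : ℂ → ℝ, IsNonzeroHarmonicOnDisc u ∧ HasZeroLimitsAlong h u ∧
      (fun r : ℝ => circleMax (fun z => |u z|) r) =O[𝓝[<] 1] (fun r : ℝ => ((1 - r) ^ 2)⁻¹) := by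
  have hE : Differentiable ℂ fun ζ : ℂ => ζ ^ 2 := by fun_prop
  refine ⟨fun z => 1 * ((lowerHalfPlaneMap z) ^ 2).im,
    isNonzeroHarmonicOnDisc_of_entire hE ⟨1 - Complex.I, by simp, by simp [sq]⟩ one_pos,
    hasZeroLimitsAlong_of_entire hE (fun x => by simp [sq]) 1 ?_, ?_⟩
  · have him : Tendsto Complex.im (𝓝[modelDomain h] 0) (𝓝[>] 0) :=
      tendsto_nhdsWithin_iff.2
        ⟨(Complex.continuous_im.tendsto' 0 0 rfl).mono_left nhdsWithin_le_nhds,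
          eventually_nhdsWithin_of_forall fun w hw => hw.2.1⟩
    have h0 : Tendsto (fun t : ℝ => 2 * (h t / t ^ 3)) (𝓝[>] 0) (𝓝 0) := by
      simpa using ho.tendsto_div_nhds_zero.const_mul 2
    refine squeeze_zero_norm' ?_ (h0.comp him)
    filter_upwards [self_mem_nhdsWithin] with w hw
    obtain ⟨hx, hy, -⟩ := hw
    have hN : w.im ^ 2 ≤ Complex.normSq w := by
      rw [Complex.normSq_apply]; nlinarith [mul_self_nonneg w.re]
    have hNpos : 0 < Complex.normSq w := lt_of_lt_of_le (by positivity) hN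
    -- Im w⁻² = -2xy/|w|⁴, and |w| ≥ y together with |x| ≤ h(y) bounds it by 2h(y)/y³.
    have heq : ((w⁻¹) ^ 2).im = -(2 * w.re * w.im) / Complex.normSq w ^ 2 := by
      simp only [sq, Complex.mul_im, Complex.inv_re, Complex.inv_im]
      field_simp
      ring
    rw [heq, Real.norm_eq_abs, abs_div, abs_neg, abs_mul, abs_mul, abs_two, abs_of_pos hy,
      abs_of_pos (by positivity : 0 < Complex.normSq w ^ 2)]
    have hh : 0 ≤ h w.im := (abs_nonneg _).trans hx
    calc 2 * |w.re| * w.im / Complex.normSq w ^ 2 ≤ 2 * h w.im * w.im / (w.im ^ 2) ^ 2 := by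
          gcongr
      _ = 2 * (h w.im / w.im ^ 3) := by field_simp
  · refine IsBigO.of_bound 4 ?_
    filter_upwards [Ioo_mem_nhdsLT (zero_lt_one (α := ℝ))] with r hr
    have h1 : 0 < 1 - r := by linarith [hr.2]
    rw [Real.norm_of_nonneg (circleMax_abs_nonneg _ _), Real.norm_of_nonneg (by positivity)]
    refine circleMax_abs_le hr.1.le fun z hz => ?_
    rw [one_mul]
    refine (Complex.abs_im_le_norm _).trans ?_
    rw [norm_pow]
    calc ‖lowerHalfPlaneMap z‖ ^ 2 ≤ (2 / (1 - ‖z‖)) ^ 2 := by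
          gcongr
          exact norm_lowerHalfPlaneMap_le (by rw [hz]; exact hr.2)
      _ = 4 * ((1 - r) ^ 2)⁻¹ := by rw [hz]; field_simp; norm_num

/-! ### Sectors and thinner cusps: tracts built from powers of p -/

lemma arg_ne_pi_of_re_pos {p : ℂ} (hp : 0 < p.re) : p.arg ≠ Real.pi := by
  intro h
  have := (Complex.abs_arg_lt_pi_div_two_iff.2 (Or.inl hp))
  rw [h, abs_of_pos Real.pi_pos] at this
  linarith [Real.pi_pos]

lemma conj_cpow_ofReal {p : ℂ} (hp : 0 < p.re) (s : ℝ) :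
    (starRingEnd ℂ p) ^ (s : ℂ) = starRingEnd ℂ (p ^ (s : ℂ)) := by
  rw [Complex.conj_cpow _ _ (arg_ne_pi_of_re_pos hp), Complex.conj_ofReal]

/-- Powers with exponent in `(0, 1)` map the right half-plane into a sector. -/
lemma cpow_re_ge {p : ℂ} (hp : 0 < p.re) {s : ℝ} (hs0 : 0 ≤ s) (hs1 : s ≤ 1) :
    ‖p‖ ^ s * Real.cos (s * (Real.pi / 2)) ≤ (p ^ (s : ℂ)).re := by
  rw [Complex.cpow_ofReal_re]
  refine mul_le_mul_of_nonneg_left ?_ (by positivity)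
  have h := (Complex.abs_arg_lt_pi_div_two_iff.2 (Or.inl hp)).le
  rw [← Real.cos_abs (p.arg * s), abs_mul, abs_of_nonneg hs0, mul_comm |p.arg|]
  refine Real.cos_le_cos_of_nonneg_of_le_pi (by positivity) ?_ (by gcongr)
  nlinarith [Real.pi_pos]

lemma re_posPart_lowerHalfPlaneMap_add_one_le {z : ℂ} (hz : ‖z‖ < 1) :
    max (lowerHalfPlaneMap z).re 0 + 1 ≤ 3 * (1 - ‖z‖)⁻¹ := by
  have h1 : 0 < 1 - ‖z‖ := by linarith
  have h2 : max (lowerHalfPlaneMap z).re 0 ≤ 2 / (1 - ‖z‖) :=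
    max_le ((Complex.re_le_norm _).trans (norm_lowerHalfPlaneMap_le hz)) (by positivity)
  have h3 : 1 ≤ (1 - ‖z‖)⁻¹ := (one_le_inv₀ h1).2 (by linarith [norm_nonneg z])
  rw [div_eq_mul_inv] at h2
  linarith

lemma abs_mul_im_le {δ : ℝ} (hδ : 0 < δ) (w : ℂ) : |δ * w.im| ≤ δ * ‖w‖ := by
  rw [abs_mul, abs_of_pos hδ]
  gcongr
  exact Complex.abs_im_le_norm w

lemma inv_re_abs_le {w : ℂ} {c : ℝ} (h : |w.re| ≤ c * w.im) (hy : 0 < w.im) :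
    |(w⁻¹).re| ≤ c * |(w⁻¹).im| := by
  have h0 : w ≠ 0 := by rintro rfl; simp at hy
  have hN : 0 < Complex.normSq w := Complex.normSq_pos.2 h0
  rw [Complex.inv_re, Complex.inv_im, abs_div, abs_div, abs_neg, abs_of_pos hN, abs_of_pos hy,
    ← mul_div_assoc]
  gcongr

/-- The function x - c|y| is nonpositive at ζ and is (1 + c)-Lipschitz. -/
lemma sector_separation {c : ℝ} (hc : 0 < c) {s ζ : ℂ} (hζ : |ζ.re| ≤ c * |ζ.im|) :
    (s.re - c * |s.im|) / (1 + c) ≤ ‖s - ζ‖ := by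
  have h1 : s.re - ζ.re ≤ ‖s - ζ‖ := by simpa using Complex.re_le_norm (s - ζ)
  have h2 : |s.im - ζ.im| ≤ ‖s - ζ‖ := by simpa using Complex.abs_im_le_norm (s - ζ)
  have h3 : |ζ.im| ≤ |s.im| + |s.im - ζ.im| := by
    have := abs_sub_abs_le_abs_sub ζ.im s.im
    rw [abs_sub_comm] at this
    linarith
  have h4 := le_abs_self ζ.re
  rw [div_le_iff₀ (by positivity)]
  nlinarith

/-- Inversion keeps the sector |x| ≤ c|y|, whose complement around the positive axis has half-angle
β = arctan(1/c). With α = 2β/π, the map K p^α sends the right half-plane onto that complement, and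
inverting the power gives growth of order ρ = 1/α = π/(2β). -/
theorem exists_harmonic_of_sector {c ε : ℝ} (hc : 0 < c) (hε : 0 < ε) :
    ∃ u : ℂ → ℝ, IsNonzeroHarmonicOnDisc u ∧ HasZeroLimitsAlong (fun t => c * t) u ∧
      ∀ r ∈ Ioo (0 : ℝ) 1, Real.posLog (circleMax (fun z => |u z|) r) ≤
        ε * (1 - r) ^ (-(Real.pi / (2 * Real.arctan (1 / c)))) := by
  set β := Real.arctan (1 / c) with hβ
  have hβ0 : 0 < β := Real.arctan_pos.2 (by positivity)
  have hβ1 : β < Real.pi / 2 := Real.arctan_lt_pi_div_two _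
  have hcos : 0 < Real.cos β := Real.cos_arctan_pos _
  have hsin : 0 < Real.sin β := Real.sin_pos_of_pos_of_lt_pi hβ0 (by linarith [Real.pi_pos])
  have hcs : c * Real.sin β = Real.cos β := by
    have h := Real.tan_arctan (1 / c)
    rw [← hβ, Real.tan_eq_sin_div_cos, div_eq_div_iff hcos.ne' hc.ne'] at h
    linarith
  set α := 2 * β / Real.pi with hα
  have hα0 : 0 < α := by positivity
  have hα1 : α < 1 := by rw [hα, div_lt_one Real.pi_pos]; linarith
  have hαβ : α * (Real.pi / 2) = β := by rw [hα]; field_simp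
  set ρ := Real.pi / (2 * β) with hρ
  have hρ0 : 0 < ρ := by positivity
  have hαρ : α * ρ = 1 := by rw [hα, hρ]; field_simp
  -- Chosen so that (3/(K cos β))^ρ = ε, the 3 coming from
  -- `re_posPart_lowerHalfPlaneMap_add_one_le`.
  set K := 3 / (Real.cos β * ε ^ α) with hK
  have hK0 : 0 < K := by positivity
  have hnorm : ∀ p : ℂ, 1 ≤ p.re → 1 ≤ ‖p‖ := fun p hp => hp.trans (Complex.re_le_norm p)
  have hRe : ∀ p : ℂ, 1 ≤ p.re →
      K * (‖p‖ ^ α * Real.cos β) ≤ ((K : ℂ) * p ^ (α : ℂ)).re := by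
    intro p hp
    rw [Complex.re_ofReal_mul, ← hαβ]
    gcongr
    exact cpow_re_ge (by linarith) hα0.le hα1.le
  set ν : ℝ → ℝ := fun x => max 1 (((x + 1) / (K * Real.cos β)) ^ ρ) with hν
  obtain ⟨E, hE, hreal, hne, ⟨C, hC, hgrow⟩, hsmall⟩ :=
    exists_entire_small_off_tract (ψ := fun p => K * p ^ (α : ℂ)) (n₀ := 1) (ν := ν) le_rfl
      (by
        refine (differentiableOn_id.cpow_const fun p hp => ?_).const_mul _
        exact Or.inl (lt_of_lt_of_le one_pos hp))
      (fun p hp => by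
        simp only [map_mul, Complex.conj_ofReal]
        rw [conj_cpow_ofReal (by linarith)])
      (fun p hp => le_trans (by positivity) (hRe p hp))
      (fun x _ => le_max_left _ _)
      (fun x hx p hp => by
        refine le_trans ?_ (hRe p ((le_max_left _ _).trans hp))
        have h1 : (x + 1) / (K * Real.cos β) ≤ ‖p‖ ^ α := by
          calc (x + 1) / (K * Real.cos β)
              = (((x + 1) / (K * Real.cos β)) ^ ρ) ^ α := by
                rw [← Real.rpow_mul (by positivity), mul_comm ρ, hαρ, Real.rpow_one]
            _ ≤ ‖p‖ ^ α := by
                gcongr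
                exact (le_max_right _ _).trans (hp.trans (Complex.re_le_norm p))
        rw [div_le_iff₀ (by positivity)] at h1
        linarith)
  have hsmall' := (hsmall {ζ | |ζ.re| ≤ c * |ζ.im|} (K * (2 * α / Real.pi) / (1 + c))
    (by positivity) ?_).1
  -- The factor (C e)⁻¹ cancels C and the 1 lost in bounding max(1, ·) by 1 + (·), so the estimate
  -- holds for every r.
  · refine ⟨fun z => (C * Real.exp 1)⁻¹ * (E (lowerHalfPlaneMap z)).im,
      isNonzeroHarmonicOnDisc_of_entire hE hne (by positivity),
      hasZeroLimitsAlong_of_entire hE hreal _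
        (tendsto_im_comp_inv (fun w hw => inv_re_abs_le hw.1 hw.2.1) hsmall'), ?_⟩
    rintro r ⟨hr0, hr1⟩
    have hr : 0 < 1 - r := by linarith
    refine posLog_le_of_le_exp (circleMax_abs_nonneg _ _) (by positivity)
      (circleMax_abs_le hr0.le fun z hz => ?_)
    refine (abs_mul_im_le (by positivity) _).trans ?_
    rw [inv_mul_le_iff₀ (by positivity), mul_assoc, ← Real.exp_add]
    refine (hgrow _).trans ?_
    gcongr
    have h3 := re_posPart_lowerHalfPlaneMap_add_one_le (z := z) (by linarith)
    rw [hz] at h3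
    refine max_le (by linarith [(by positivity : 0 < ε * (1 - r) ^ (-ρ))]) ?_
    have h4 : ((max (lowerHalfPlaneMap z).re 0 + 1) / (K * Real.cos β)) ^ ρ ≤
        ε * (1 - r) ^ (-ρ) := by
      calc ((max (lowerHalfPlaneMap z).re 0 + 1) / (K * Real.cos β)) ^ ρ
          ≤ (3 * (1 - r)⁻¹ / (K * Real.cos β)) ^ ρ := by gcongr
        _ = (ε ^ α * (1 - r)⁻¹) ^ ρ := by
            congr 1
            rw [hK]
            have := hcos.ne'
            field_simp
        _ = ε * (1 - r) ^ (-ρ) := by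
            rw [Real.mul_rpow (by positivity) (by positivity), ← Real.rpow_mul hε.le, hαρ,
              Real.rpow_one, Real.inv_rpow hr.le, Real.rpow_neg hr.le]
    linarith
  · intro ζ hζ p hp
    refine le_trans ?_ (sector_separation hc hζ)
    have hp0 : 0 < p.re := by linarith
    have hn := hnorm p hp
    have harg := Complex.abs_arg_lt_pi_div_two_iff.2 (Or.inl hp0)
    set θ := |p.arg| with hθ
    have hθ0 : 0 ≤ θ := abs_nonneg _
    have him : |((K : ℂ) * p ^ (α : ℂ)).im| = K * (‖p‖ ^ α * Real.sin (α * θ)) := by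
      have h1 : 0 ≤ Real.sin (α * θ) :=
        Real.sin_nonneg_of_nonneg_of_le_pi (by positivity) (by nlinarith [Real.pi_pos])
      have h2 : |p.arg * α| ≤ Real.pi := by
        rw [abs_mul, abs_of_pos hα0]; nlinarith [Real.pi_pos]
      rw [Complex.im_ofReal_mul, Complex.cpow_ofReal_im, abs_mul, abs_mul, abs_of_pos hK0,
        abs_of_nonneg (by positivity : 0 ≤ ‖p‖ ^ α), Real.abs_sin_eq_sin_abs_of_abs_le_pi h2,
        abs_mul, abs_of_pos hα0, mul_comm |p.arg|]
    have hre' : ((K : ℂ) * p ^ (α : ℂ)).re = K * (‖p‖ ^ α * Real.cos (α * θ)) := by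
      rw [Complex.re_ofReal_mul, Complex.cpow_ofReal_re, ← Real.cos_abs (p.arg * α), abs_mul,
        abs_of_pos hα0, mul_comm |p.arg|]
    rw [him, hre', div_right_comm]
    have hx0 : 0 ≤ Real.pi / 2 - θ := by linarith
    -- Re p ≥ 1 keeps arg p at least 1/|p| away from ±π/2; after the power, Jordan's inequality
    -- turns this into a gap of order 1/|p| from the edge of the sector.
    have hsinβ : (2 * α / Real.pi) / ‖p‖ ≤ Real.sin (β - α * θ) := by
      have h1 : β - α * θ = α * (Real.pi / 2 - θ) := by rw [mul_sub, hαβ]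
      have h2 : 2 / Real.pi * (β - α * θ) ≤ Real.sin (β - α * θ) := by
        refine Real.mul_le_sin (by rw [h1]; positivity) ?_
        have : 0 ≤ α * θ := by positivity
        linarith
      refine le_trans ?_ h2
      have h3 : p.re / ‖p‖ ≤ Real.pi / 2 - θ := by
        rw [← Complex.cos_arg (norm_pos_iff.1 (by linarith)), ← Real.cos_abs,
          ← Real.sin_pi_div_two_sub]
        exact Real.sin_le hx0
      rw [h1]
      calc (2 * α / Real.pi) / ‖p‖ = 2 / Real.pi * (α * (1 / ‖p‖)) := by ring
        _ ≤ 2 / Real.pi * (α * (p.re / ‖p‖)) := by gcongr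
        _ ≤ _ := by gcongr
    have hdiff : Real.sin (β - α * θ) ≤ Real.cos (α * θ) - c * Real.sin (α * θ) := by
      have h1 : Real.sin β * (Real.cos (α * θ) - c * Real.sin (α * θ)) =
          Real.sin (β - α * θ) := by
        rw [Real.sin_sub, ← hcs]; ring
      have h2 : 0 ≤ Real.sin (β - α * θ) := le_trans (by positivity) hsinβ
      have h3 := Real.sin_le_one β
      have h4 : 0 ≤ Real.cos (α * θ) - c * Real.sin (α * θ) := by
        by_contra! h
        nlinarith
      nlinarith
    have hpow : 1 ≤ ‖p‖ ^ α := Real.one_le_rpow hn hα0.le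
    have hq : 0 ≤ (2 * α / Real.pi) / ‖p‖ := by positivity
    gcongr ?_ / (1 + c)
    calc K * (2 * α / Real.pi) / ‖p‖ = K * (1 * ((2 * α / Real.pi) / ‖p‖)) := by ring
      _ ≤ K * (‖p‖ ^ α * (Real.cos (α * θ) - c * Real.sin (α * θ))) := by
          gcongr
          exact hsinβ.trans hdiff
      _ = _ := by ring

/-- The inverted domain lies in |Re ζ| ≤ |ζ|^σ with σ < 1. In K(p + p^s) the linear term gives ν(x)
of size x/K, hence exponential type, while p^s with s > σ pushes the image of a vertical line to the
right of that region. -/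
theorem exists_harmonic_of_rpow_gt_one {γ ε : ℝ} (hγ : 1 < γ) (hε : 0 < ε) :
    ∃ u : ℂ → ℝ, IsNonzeroHarmonicOnDisc u ∧ HasZeroLimitsAlong (fun t => t ^ γ) u ∧
      ∀ r ∈ Ioo (0 : ℝ) 1,
        Real.posLog (circleMax (fun z => |u z|) r) ≤ ε * (1 - r)⁻¹ := by
  -- Capping γ at 3/2 keeps σ positive; it only enlarges the domain, since y < 1.
  set σ := 2 - min γ (3 / 2) with hσ
  have hσ0 : 0 < σ := by have := min_le_right γ (3 / 2 : ℝ); linarith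
  have hσ1 : σ < 1 := by
    have : 1 < min γ (3 / 2 : ℝ) := lt_min hγ (by norm_num)
    linarith
  obtain ⟨s, hσs, hs1⟩ := exists_between hσ1
  have hs0 : 0 < s := hσ0.trans hσs
  set K := 3 / ε with hK
  have hK0 : 0 < K := by positivity
  set κ := Real.cos (s * (Real.pi / 2)) with hκ
  have hκ0 : 0 < κ := by
    refine Real.cos_pos_of_mem_Ioo ⟨?_, ?_⟩ <;> nlinarith [Real.pi_pos]
  -- Any ζ within distance 1 of ψ(p) has |ζ| ≤ 2K|p| + 1, so this inequality excludes it from the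
  -- region when |p| is large; the final 1 is the separation.
  have hlarge : ∀ᶠ R : ℝ in atTop, (2 * K * R + 1) ^ σ + 1 ≤ K * (κ * R ^ s) := by
    have h1 := (tendsto_rpow_atTop (sub_pos.2 hσs)).eventually_ge_atTop
      (((2 * K + 1) ^ σ + 1) / (K * κ))
    filter_upwards [h1, eventually_ge_atTop 1] with R hR hR1
    rw [div_le_iff₀ (by positivity)] at hR
    have h2 : 1 ≤ R ^ σ := Real.one_le_rpow hR1 hσ0.le
    calc (2 * K * R + 1) ^ σ + 1 ≤ ((2 * K + 1) * R) ^ σ + 1 := by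
          gcongr
          nlinarith
      _ ≤ ((2 * K + 1) ^ σ + 1) * R ^ σ := by
          rw [Real.mul_rpow (by positivity) (by positivity)]
          linarith
      _ ≤ R ^ (s - σ) * (K * κ) * R ^ σ := by gcongr
      _ = K * (κ * (R ^ (s - σ) * R ^ σ)) := by ring
      _ = _ := by rw [← Real.rpow_add (by linarith), sub_add_cancel]
  obtain ⟨N, hN⟩ := eventually_atTop.1 hlarge
  set n₀ := max 1 N with hn₀
  have hn1 : 1 ≤ n₀ := le_max_left _ _
  have hRe : ∀ p : ℂ, n₀ ≤ p.re →
      K * p.re + K * (κ * ‖p‖ ^ s) ≤ ((K : ℂ) * (p + p ^ (s : ℂ))).re := by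
    intro p hp
    have := cpow_re_ge (p := p) (by linarith) hs0.le hs1.le
    rw [Complex.re_ofReal_mul, Complex.add_re, mul_add]
    gcongr
    rwa [mul_comm]
  set ν : ℝ → ℝ := fun x => max n₀ ((x + 1) / K) with hν
  obtain ⟨E, hE, hreal, hne, ⟨C, hC, hgrow⟩, hsmall⟩ :=
    exists_entire_small_off_tract (ψ := fun p => K * (p + p ^ (s : ℂ))) (n₀ := n₀) (ν := ν) hn1
      (by
        refine (differentiableOn_id.add
          (differentiableOn_id.cpow_const fun p (hp : n₀ ≤ p.re) => ?_)).const_mul _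
        exact Or.inl (by simp only [id]; linarith))
      (fun p hp => by
        simp only [map_mul, map_add, Complex.conj_ofReal]
        rw [conj_cpow_ofReal (by linarith)])
      (fun p hp => by
        refine le_trans ?_ (hRe p hp)
        have : 0 < p.re := by linarith
        positivity)
      (fun x _ => le_max_left _ _)
      (fun x hx p hp => by
        refine le_trans ?_ (hRe p ((le_max_left _ _).trans hp))
        have h1 := (le_max_right n₀ _).trans hp
        rw [div_le_iff₀ hK0] at h1
        have : 0 ≤ K * (κ * ‖p‖ ^ s) := by positivity
        linarith)
  have hsmall' := (hsmall {ζ | |ζ.re| ≤ ‖ζ‖ ^ σ} 1 one_pos ?_).1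
  · have hmem : ∀ w ∈ modelDomain (fun t => t ^ γ), w⁻¹ ∈ {ζ : ℂ | |ζ.re| ≤ ‖ζ‖ ^ σ} := by
      rintro w ⟨hx, hy, hy1⟩
      have hw : 0 < ‖w‖ := lt_of_lt_of_le hy (Complex.im_le_norm w)
      have h1 : |w.re| ≤ ‖w‖ ^ (2 - σ) := by
        have hγ' : 2 - σ = min γ (3 / 2) := by rw [hσ]; ring
        calc |w.re| ≤ w.im ^ γ := hx
          _ ≤ w.im ^ (2 - σ) :=
            Real.rpow_le_rpow_of_exponent_ge hy hy1.le (by rw [hγ']; exact min_le_left _ _)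
          _ ≤ ‖w‖ ^ (2 - σ) := Real.rpow_le_rpow hy.le (Complex.im_le_norm w) (by linarith)
      show |(w⁻¹).re| ≤ ‖w⁻¹‖ ^ σ
      rw [Complex.inv_re, abs_div, Complex.normSq_eq_norm_sq,
        abs_of_pos (by positivity : 0 < ‖w‖ ^ 2), div_le_iff₀ (by positivity), norm_inv,
        Real.inv_rpow hw.le, ← Real.rpow_neg hw.le,
        ← Real.rpow_natCast ‖w‖ 2, ← Real.rpow_add hw]
      rwa [show -σ + ((2 : ℕ) : ℝ) = 2 - σ by push_cast; ring]
    refine ⟨fun z => (C * Real.exp n₀)⁻¹ * (E (lowerHalfPlaneMap z)).im,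
      isNonzeroHarmonicOnDisc_of_entire hE hne (by positivity),
      hasZeroLimitsAlong_of_entire hE hreal _ (tendsto_im_comp_inv hmem hsmall'), ?_⟩
    rintro r ⟨hr0, hr1⟩
    have hr : 0 < 1 - r := by linarith
    refine posLog_le_of_le_exp (circleMax_abs_nonneg _ _) (by positivity)
      (circleMax_abs_le hr0.le fun z hz => ?_)
    refine (abs_mul_im_le (by positivity) _).trans ?_
    rw [inv_mul_le_iff₀ (by positivity), mul_assoc, ← Real.exp_add]
    refine (hgrow _).trans ?_
    gcongr
    have h3 := re_posPart_lowerHalfPlaneMap_add_one_le (z := z) (by linarith)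
    rw [hz] at h3
    refine max_le (by linarith [(by positivity : 0 < ε * (1 - r)⁻¹)]) ?_
    have h4 : (max (lowerHalfPlaneMap z).re 0 + 1) / K ≤ ε * (1 - r)⁻¹ := by
      rw [div_le_iff₀ hK0]
      refine h3.trans (le_of_eq ?_)
      rw [hK]
      field_simp
    linarith
  · intro ζ hζ p hp
    have hp1 : 1 ≤ p.re := hn1.trans hp
    have hpn : p.re ≤ ‖p‖ := Complex.re_le_norm p
    suffices h : 1 ≤ ‖(K : ℂ) * (p + p ^ (s : ℂ)) - ζ‖ from
      ((div_le_one (by linarith)).2 (by linarith)).trans h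
    by_contra! hlt
    have h1 := hRe p hp
    have h2 := (Complex.re_le_norm _).trans_lt hlt
    rw [Complex.sub_re] at h2
    have h3 : ‖(K : ℂ) * (p + p ^ (s : ℂ))‖ ≤ 2 * K * ‖p‖ := by
      rw [norm_mul, Complex.norm_real, Real.norm_of_nonneg hK0.le]
      have h4 : ‖p ^ (s : ℂ)‖ ≤ ‖p‖ := by
        rw [Complex.norm_cpow_real]
        calc ‖p‖ ^ s ≤ ‖p‖ ^ (1 : ℝ) :=
              Real.rpow_le_rpow_of_exponent_le (by linarith) hs1.le
          _ = ‖p‖ := Real.rpow_one _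
      have := norm_add_le p (p ^ (s : ℂ))
      nlinarith
    have h5 : ‖ζ‖ ≤ 2 * K * ‖p‖ + 1 := by
      have := norm_sub_norm_le ζ ((K : ℂ) * (p + p ^ (s : ℂ)))
      rw [norm_sub_rev] at this
      linarith
    have h6 : ‖ζ‖ ^ σ ≤ (2 * K * ‖p‖ + 1) ^ σ := by gcongr
    have h7 := hN ‖p‖ (((le_max_right 1 N).trans hp).trans hpn)
    have h8 : |ζ.re| ≤ ‖ζ‖ ^ σ := hζ
    have h9 := le_abs_self ζ.re
    have h10 : 0 < K * p.re := by positivity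
    linarith

/-! ### Domains wider than sectors: tracts built from powers of the logarithm -/

/-- Powers of a point in a thin neighbourhood of the positive axis. -/
lemma cpow_bounds_of_abs_im_le {q : ℂ} {b : ℝ} (hb : 0 < b) (hq : 0 < q.re) (h6 : 6 * b ≤ ‖q‖)
    (him : |q.im| ≤ Real.pi / 2) :
    3 / 4 * ‖q‖ ^ b ≤ (q ^ (b : ℂ)).re ∧ |(q ^ (b : ℂ)).im| ≤ 3 * b / ‖q‖ * ‖q‖ ^ b := by
  have hq0 : 0 < ‖q‖ := lt_of_lt_of_le hq (Complex.re_le_norm q)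
  have harg := (Complex.abs_arg_lt_pi_div_two_iff.2 (Or.inl hq)).le
  -- Jordan's inequality gives |arg q| ≤ (π²/4)/|q|, and π²/4 < 3.
  have h1 : |q.arg| ≤ 3 / ‖q‖ := by
    have h2 := Real.mul_abs_le_abs_sin harg
    rw [Complex.sin_arg, abs_div, abs_of_pos hq0, le_div_iff₀ hq0] at h2
    rw [le_div_iff₀ hq0]
    have h3 : 2 / Real.pi * |q.arg| * ‖q‖ ≤ Real.pi / 2 := h2.trans him
    have h4 : |q.arg| * ‖q‖ = Real.pi / 2 * (2 / Real.pi * |q.arg| * ‖q‖) := by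
      have := Real.pi_pos.ne'
      field_simp
    rw [h4]
    have := Real.pi_lt_d2
    have := Real.pi_pos
    calc Real.pi / 2 * (2 / Real.pi * |q.arg| * ‖q‖) ≤ Real.pi / 2 * (Real.pi / 2) := by gcongr
      _ ≤ 3 := by nlinarith
  have h2 : |q.arg * b| ≤ 3 * b / ‖q‖ := by
    rw [abs_mul, abs_of_pos hb]
    calc |q.arg| * b ≤ 3 / ‖q‖ * b := by gcongr
      _ = _ := by ring
  have h3 : 3 * b / ‖q‖ ≤ 1 / 2 := by
    rw [div_le_iff₀ hq0]; linarith
  have hpow : 0 ≤ ‖q‖ ^ b := by positivity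
  constructor
  · rw [Complex.cpow_ofReal_re, mul_comm]
    refine mul_le_mul_of_nonneg_left ?_ hpow
    have h4 := Real.one_sub_sq_div_two_le_cos (x := q.arg * b)
    have h5 : (q.arg * b) ^ 2 ≤ (1 / 2) ^ 2 := sq_le_sq' (by linarith [neg_abs_le (q.arg * b)])
      (by linarith [le_abs_self (q.arg * b)])
    linarith
  · rw [Complex.cpow_ofReal_im, abs_mul, abs_of_nonneg hpow, mul_comm]
    gcongr
    exact Real.abs_sin_le_abs.trans h2

/-- A disc around a point near the positive axis avoids the inverted cuspidal approach domain. -/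
lemma cusp_separation {a e Q : ℝ} (ha : 0 < a) (he : 0 < e) (he6 : e ≤ 1 / 6) (hQ : 0 < Q)
    (hsmall : 16 * 8 ^ (1 + a) * (e * Q ^ a) < 1) {s ζ : ℂ} (hre : 3 / 4 * Q ≤ s.re)
    (him : |s.im| ≤ 3 * e * Q) (hs : ‖s‖ ≤ Q)
    (hζ : (|ζ.re| / ‖ζ‖ ^ 2) ^ (1 + a) ≤ |ζ.im| / ‖ζ‖ ^ 2) : Q * e ≤ ‖s - ζ‖ := by
  by_contra! hlt
  have h1 : s.re - ζ.re ≤ ‖s - ζ‖ := by simpa using Complex.re_le_norm (s - ζ)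
  have h2 : |s.im - ζ.im| ≤ ‖s - ζ‖ := by simpa using Complex.abs_im_le_norm (s - ζ)
  have h3 : |ζ.im| ≤ |s.im| + |s.im - ζ.im| := by
    have := abs_sub_abs_le_abs_sub ζ.im s.im
    rw [abs_sub_comm] at this
    linarith
  have h4 : ‖ζ‖ ≤ ‖s‖ + ‖s - ζ‖ := by
    have := norm_sub_norm_le ζ s
    rw [norm_sub_rev] at this
    linarith
  have hQe : Q * e ≤ Q * (1 / 6) := by gcongr
  have hξ : Q / 2 ≤ |ζ.re| := le_trans (by linarith) (le_abs_self _)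
  have hη : |ζ.im| ≤ 4 * (Q * e) := by linarith
  have hN2 : ‖ζ‖ ≤ 2 * Q := by linarith
  have hN1 : Q / 2 ≤ ‖ζ‖ := hξ.trans (Complex.abs_re_le_norm ζ)
  have hN0 : 0 < ‖ζ‖ := by linarith
  -- A point ζ this close to s has |Re ζ|/|ζ|² ≥ 1/(8Q) and |Im ζ|/|ζ|² ≤ 16e/Q; the cusp inequality
  -- would then give 1 ≤ 16·8^(1+a) e Q^a.
  have hl : (1 / (8 * Q)) ^ (1 + a) ≤ (|ζ.re| / ‖ζ‖ ^ 2) ^ (1 + a) := by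
    gcongr ?_ ^ (1 + a)
    calc 1 / (8 * Q) = (Q / 2) / (2 * Q) ^ 2 := by field_simp; norm_num
      _ ≤ _ := by gcongr
  have hr : |ζ.im| / ‖ζ‖ ^ 2 ≤ 16 * e / Q := by
    calc |ζ.im| / ‖ζ‖ ^ 2 ≤ 4 * (Q * e) / (Q / 2) ^ 2 := by gcongr
      _ = _ := by field_simp; norm_num
  have h5 := hl.trans (hζ.trans hr)
  rw [Real.div_rpow one_pos.le (by positivity), Real.one_rpow,
    Real.mul_rpow (by norm_num) hQ.le, div_le_div_iff₀ (by positivity) hQ,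
    Real.rpow_add hQ, Real.rpow_one] at h5
  have h6 : 16 * e * (8 ^ (1 + a) * (Q * Q ^ a)) = 16 * 8 ^ (1 + a) * (e * Q ^ a) * Q := by ring
  rw [h6] at h5
  nlinarith

/-- For ζ = 1/w the quotients |Re ζ|/|ζ|² and |Im ζ|/|ζ|² are |Re w| and Im w, and 1 + a = 1/γ. -/
lemma inv_mem_cusp {γ a : ℝ} (hγ : γ * (1 + a) = 1) {w : ℂ} (ha : 0 < a)
    (hx : |w.re| ≤ w.im ^ γ) (hy : 0 < w.im) :
    (|(w⁻¹).re| / ‖w⁻¹‖ ^ 2) ^ (1 + a) ≤ |(w⁻¹).im| / ‖w⁻¹‖ ^ 2 := by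
  have hw : 0 < ‖w‖ := lt_of_lt_of_le hy (Complex.im_le_norm w)
  have h1 : |(w⁻¹).re| / ‖w⁻¹‖ ^ 2 = |w.re| := by
    rw [Complex.inv_re, abs_div, Complex.normSq_eq_norm_sq,
      abs_of_pos (by positivity : 0 < ‖w‖ ^ 2), norm_inv]
    field_simp
  have h2 : |(w⁻¹).im| / ‖w⁻¹‖ ^ 2 = w.im := by
    rw [Complex.inv_im, abs_div, abs_neg, abs_of_pos hy, Complex.normSq_eq_norm_sq,
      abs_of_pos (by positivity : 0 < ‖w‖ ^ 2),
      norm_inv]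
    field_simp
  rw [h1, h2]
  calc |w.re| ^ (1 + a) ≤ (w.im ^ γ) ^ (1 + a) := by gcongr
    _ = w.im := by rw [← Real.rpow_mul hy.le, hγ, Real.rpow_one]

/-- Outside of the approach domain, the point `1/w` is controlled by the distance to the circle. -/
lemma re_posPart_le_of_not_mem {γ : ℝ} (hγ0 : 0 < γ) (hγ1 : γ < 1) {z : ℂ} (hz : ‖z‖ < 1)
    (h : (lowerHalfPlaneMap z)⁻¹ ∉ modelDomain fun t => t ^ γ) :
    max (lowerHalfPlaneMap z).re 0 + 1 ≤ 5 * (1 - ‖z‖) ^ (-γ) := by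
  set w := (lowerHalfPlaneMap z)⁻¹ with hw
  have hq : 0 < 1 - ‖z‖ := by linarith
  have hy := le_im_inv_lowerHalfPlaneMap hz
  rw [← hw] at hy
  have hy0 : 0 < w.im := by linarith
  have hwn : 0 < ‖w‖ := lt_of_lt_of_le hy0 (Complex.im_le_norm w)
  have hone : 1 ≤ (1 - ‖z‖) ^ (-γ) :=
    Real.one_le_rpow_of_pos_of_le_one_of_nonpos hq (by linarith [norm_nonneg z]) (by linarith)
  have hre : (lowerHalfPlaneMap z).re ≤ ‖w‖⁻¹ := by
    rw [hw, norm_inv, inv_inv]; exact Complex.re_le_norm _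
  suffices hsuff : ‖w‖⁻¹ ≤ 4 * (1 - ‖z‖) ^ (-γ) by
    have := max_le (hre.trans hsuff) (by positivity)
    linarith
  by_cases hy1 : w.im < 1
  · have hx : w.im ^ γ < |w.re| := by
      by_contra! hx
      exact h ⟨hx, hy0, hy1⟩
    calc ‖w‖⁻¹ ≤ (w.im ^ γ)⁻¹ := by
          gcongr
          exact hx.le.trans (Complex.abs_re_le_norm w)
      _ ≤ (((1 - ‖z‖) / 4) ^ γ)⁻¹ := by gcongr
      _ = 4 ^ γ * (1 - ‖z‖) ^ (-γ) := by
          rw [Real.div_rpow hq.le (by norm_num), inv_div, Real.rpow_neg hq.le, div_eq_mul_inv]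
      _ ≤ 4 ^ (1 : ℝ) * (1 - ‖z‖) ^ (-γ) := by
          gcongr
          norm_num
      _ = _ := by rw [Real.rpow_one]
  · push Not at hy1
    have : ‖w‖⁻¹ ≤ 1 := inv_le_one_of_one_le₀ (hy1.trans (Complex.im_le_norm w))
    linarith

/-- The logarithm sends the half-plane into a strip, and the power b = 1/a bends the strip into a
tract of width about K b ℓ^(b-1) at distance Q = K ℓ^b, where ℓ = |log p|. The inverted cusp leaves
a gap of width about Q^(1-a), which has the same exponent of ℓ because ab = 1; a small K makes the
tract fit. -/
theorem exists_harmonic_of_rpow_lt_one {γ : ℝ} (hγ0 : 0 < γ) (hγ1 : γ < 1) :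
    ∃ k : ℝ, 0 < k ∧ ∃ u : ℂ → ℝ, IsNonzeroHarmonicOnDisc u ∧
      HasZeroLimitsAlong (fun t => t ^ γ) u ∧ ∀ r ∈ Ioo (0 : ℝ) 1,
        Real.posLog (Real.posLog (circleMax (fun z => |u z|) r)) ≤ k * (1 - r) ^ (γ - 1) := by
  set a := γ⁻¹ - 1 with ha
  have ha0 : 0 < a := by rw [ha, sub_pos]; exact (one_lt_inv₀ hγ0).2 hγ1
  have hγa : γ * (1 + a) = 1 := by rw [ha]; field_simp; ring
  set b := a⁻¹ with hb
  have hb0 : 0 < b := by positivity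
  have hba : b * a = 1 := inv_mul_cancel₀ ha0.ne'
  -- With e = b/ℓ and Q = K ℓ^b one has e Q^a = b K^a, and this K makes 16·8^(1+a) e Q^a equal to
  -- 1/2.
  set K := ((32 * b * 8 ^ (1 + a))⁻¹) ^ b with hK
  have hK0 : 0 < K := by positivity
  have hKa : K ^ a = (32 * b * 8 ^ (1 + a))⁻¹ := by
    rw [hK, ← Real.rpow_mul (by positivity), hba, Real.rpow_one]
  set ℓ₀ := max 1 (6 * b) with hℓ₀
  have hℓ1 : 1 ≤ ℓ₀ := le_max_left _ _
  have hn1 : 1 ≤ Real.exp ℓ₀ := Real.one_le_exp (by linarith)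
  have hlog : ∀ (x : ℝ) (p : ℂ), Real.exp x ≤ p.re → x ≤ (Complex.log p).re := by
    intro x p hp
    rw [Complex.log_re, Real.le_log_iff_exp_le (lt_of_lt_of_le (Real.exp_pos _)
      (hp.trans (Complex.re_le_norm p)))]
    exact hp.trans (Complex.re_le_norm p)
  have hlogim : ∀ p : ℂ, Real.exp ℓ₀ ≤ p.re → |(Complex.log p).im| ≤ Real.pi / 2 := by
    intro p hp
    rw [Complex.log_im]
    exact (Complex.abs_arg_lt_pi_div_two_iff.2 (Or.inl (by linarith))).le
  have hlogn : ∀ p : ℂ, Real.exp ℓ₀ ≤ p.re → ℓ₀ ≤ ‖Complex.log p‖ := fun p hp =>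
    (hlog _ p hp).trans (Complex.re_le_norm _)
  have hbd : ∀ p : ℂ, Real.exp ℓ₀ ≤ p.re → _ ∧ _ := fun p hp =>
    cpow_bounds_of_abs_im_le hb0 (lt_of_lt_of_le (by linarith) (hlog _ p hp))
      ((le_max_right _ _).trans (hlogn p hp)) (hlogim p hp)
  have hRe : ∀ p : ℂ, Real.exp ℓ₀ ≤ p.re →
      3 / 4 * (K * ‖Complex.log p‖ ^ b) ≤ ((K : ℂ) * Complex.log p ^ (b : ℂ)).re := by
    intro p hp
    rw [Complex.re_ofReal_mul]
    nlinarith [(hbd p hp).1]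
  set ν : ℝ → ℝ := fun x => Real.exp (max ℓ₀ ((4 / (3 * K) * (x + 1)) ^ a)) with hν
  obtain ⟨E, hE, hreal, hne, ⟨C, hC, hgrow⟩, hsmall⟩ :=
    exists_entire_small_off_tract (ψ := fun p => K * Complex.log p ^ (b : ℂ))
      (n₀ := Real.exp ℓ₀) (ν := ν) hn1
      (by
        refine ((differentiableOn_id.clog fun p (hp : _ ≤ p.re) => ?_).cpow_const
          fun p hp => ?_).const_mul _
        · exact Or.inl (by simp only [id]; linarith)
        · exact Or.inl (lt_of_lt_of_le (by linarith) (hlog _ p hp)))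
      (fun p hp => by
        simp only [map_mul, Complex.conj_ofReal]
        rw [Complex.log_conj _ (arg_ne_pi_of_re_pos (by linarith)),
          conj_cpow_ofReal (lt_of_lt_of_le (by linarith) (hlog _ p hp))])
      (fun p hp => le_trans (by positivity) (hRe p hp))
      (fun x _ => Real.exp_le_exp.2 (le_max_left _ _))
      (fun x hx p hp => by
        refine le_trans ?_ (hRe p ((Real.exp_le_exp.2 (le_max_left _ _)).trans hp))
        have h1 : 4 / (3 * K) * (x + 1) ≤ ‖Complex.log p‖ ^ b := by
          calc 4 / (3 * K) * (x + 1) = ((4 / (3 * K) * (x + 1)) ^ a) ^ b := by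
                rw [← Real.rpow_mul (by positivity), mul_comm a, hba, Real.rpow_one]
            _ ≤ ‖Complex.log p‖ ^ b := by
                gcongr
                exact (le_max_right _ _).trans ((hlog _ p hp).trans (Complex.re_le_norm _))
        calc x + 1 = 3 / 4 * (K * (4 / (3 * K) * (x + 1))) := by field_simp
          _ ≤ _ := by gcongr)
  have hcusp :=
    hsmall {ζ | (|ζ.re| / ‖ζ‖ ^ 2) ^ (1 + a) ≤ |ζ.im| / ‖ζ‖ ^ 2} (K * b / 3) (by positivity) ?_
  · obtain ⟨hlim, C', hC'⟩ := hcusp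
    have hmem : ∀ w ∈ modelDomain (fun t => t ^ γ),
        w⁻¹ ∈ {ζ : ℂ | (|ζ.re| / ‖ζ‖ ^ 2) ^ (1 + a) ≤ |ζ.im| / ‖ζ‖ ^ 2} := fun w hw =>
      inv_mem_cusp hγa ha0 hw.1 hw.2.1
    set B := (20 / (3 * K)) ^ a with hB
    have hB0 : 0 < B := by positivity
    have hM : 0 < max C C' := lt_of_lt_of_le hC (le_max_left _ _)
    refine ⟨ℓ₀ + B, by positivity, fun z => (max C C')⁻¹ * (E (lowerHalfPlaneMap z)).im,
      isNonzeroHarmonicOnDisc_of_entire hE hne (by positivity),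
      hasZeroLimitsAlong_of_entire hE hreal _ (tendsto_im_comp_inv hmem hlim), ?_⟩
    rintro r ⟨hr0, hr1⟩
    have hr : 0 < 1 - r := by linarith
    refine posLog_le_of_le_exp Real.posLog_nonneg (by positivity)
      (posLog_le_of_le_exp (circleMax_abs_nonneg _ _) (by positivity)
      (circleMax_abs_le hr0.le fun z hz => ?_))
    refine (abs_mul_im_le (by positivity) _).trans ?_
    rw [inv_mul_le_iff₀ (by positivity)]
    -- Inside the approach domain E is bounded. Outside it Re ζ is only O((1 - r)^(-γ)), better than
    -- the general 2/(1 - r), and aγ = 1 - γ yields the stated exponent.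
    by_cases hd : (lowerHalfPlaneMap z)⁻¹ ∈ modelDomain fun t => t ^ γ
    · have h1 := hC' _ (hmem _ hd)
      rw [inv_inv] at h1
      refine h1.trans ((le_max_right C C').trans (le_mul_of_one_le_right hM.le ?_))
      exact Real.one_le_exp (by positivity)
    · have h3 := re_posPart_le_of_not_mem hγ0 hγ1 (by linarith) hd
      rw [hz] at h3
      refine (hgrow _).trans ?_
      gcongr
      · exact le_max_left _ _
      · have hone : 1 ≤ (1 - r) ^ (γ - 1) :=
          Real.one_le_rpow_of_pos_of_le_one_of_nonpos hr (by linarith) (by linarith)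
        have h4 : (4 / (3 * K) * (max (lowerHalfPlaneMap z).re 0 + 1)) ^ a ≤
            B * (1 - r) ^ (γ - 1) := by
          calc (4 / (3 * K) * (max (lowerHalfPlaneMap z).re 0 + 1)) ^ a
              ≤ (4 / (3 * K) * (5 * (1 - r) ^ (-γ))) ^ a := by gcongr
            _ = (20 / (3 * K) * (1 - r) ^ (-γ)) ^ a := by ring_nf
            _ = B * (1 - r) ^ (γ - 1) := by
              rw [Real.mul_rpow (by positivity) (by positivity), ← Real.rpow_mul hr.le, hB]
              congr 2
              linarith
        exact Real.exp_le_exp.2 (max_le (by nlinarith) (by nlinarith))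
  · intro ζ hζ p hp
    set ℓ := ‖Complex.log p‖ with hℓ
    have hℓ₁ : ℓ₀ ≤ ℓ := hlogn p hp
    have hℓ0 : 0 < ℓ := by linarith
    have hpn : 1 ≤ ‖p‖ := (hn1.trans hp).trans (Complex.re_le_norm p)
    have hsep := cusp_separation (a := a) (e := b / ℓ) (Q := K * ℓ ^ b)
      (s := (K : ℂ) * Complex.log p ^ (b : ℂ)) ha0 (by positivity) ?_ (by positivity) ?_
      (hRe p hp) ?_ ?_ hζ
    · refine le_trans ?_ hsep
      -- This is the source of the 3 in the separation constant K b/3: Q e = K ℓ^b b/ℓ ≥ K b/(3|p|).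
      have h1 : ℓ ≤ 3 * ‖p‖ := by
        have h2 : ℓ ≤ |(Complex.log p).re| + |(Complex.log p).im| :=
          Complex.norm_le_abs_re_add_abs_im _
        have h3 := hlogim p hp
        rw [Complex.log_re, abs_of_nonneg (Real.log_nonneg hpn)] at h2
        have h4 := Real.log_le_sub_one_of_pos (by linarith : 0 < ‖p‖)
        have := Real.pi_lt_d2
        linarith
      have h2 : 1 ≤ ℓ ^ b := Real.one_le_rpow (hℓ1.trans hℓ₁) hb0.le
      calc K * b / 3 / ‖p‖ = K * 1 * (b / (3 * ‖p‖)) := by field_simp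
        _ ≤ _ := by gcongr
    · rw [div_le_iff₀ hℓ0]
      have := (le_max_right 1 (6 * b)).trans hℓ₁
      linarith
    · rw [Real.mul_rpow hK0.le (by positivity), ← Real.rpow_mul hℓ0.le, hba, Real.rpow_one, hKa]
      have : (16 : ℝ) * 8 ^ (1 + a) * (b / ℓ * ((32 * b * 8 ^ (1 + a))⁻¹ * ℓ)) = 1 / 2 := by
        field_simp
        norm_num
      rw [this]
      norm_num
    · rw [Complex.im_ofReal_mul, abs_mul, abs_of_pos hK0]
      calc K * |(Complex.log p ^ (b : ℂ)).im| ≤ K * (3 * b / ℓ * ℓ ^ b) := by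
            gcongr
            exact (hbd p hp).2
        _ = _ := by ring
    · rw [norm_mul, Complex.norm_cpow_real, Complex.norm_real, Real.norm_of_nonneg hK0.le]

theorem proposition1p4 :
    (∀ h : ℝ → ℝ, IsApproachFunction h → h =o[𝓝[>] 0] (fun t : ℝ => t ^ 3) →
      ∃ u : ℂ → ℝ, IsNonzeroHarmonicOnDisc u ∧ HasZeroLimitsAlong h u ∧
        (fun r : ℝ => circleMax (fun z => |u z|) r) =O[𝓝[<] 1]
          (fun r : ℝ => ((1 - r) ^ 2)⁻¹)) ∧
    (∀ γ ε : ℝ, 1 < γ → γ ≤ 3 → 0 < ε →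
      ∃ u : ℂ → ℝ, IsNonzeroHarmonicOnDisc u ∧ HasZeroLimitsAlong (fun t => t ^ γ) u ∧
        ∀ r ∈ Ioo (0 : ℝ) 1,
          Real.posLog (circleMax (fun z => |u z|) r) ≤ ε * (1 - r)⁻¹) ∧
    (∀ c ε : ℝ, 0 < c → 0 < ε →
      ∃ u : ℂ → ℝ, IsNonzeroHarmonicOnDisc u ∧ HasZeroLimitsAlong (fun t => c * t) u ∧
        ∀ r ∈ Ioo (0 : ℝ) 1,
          Real.posLog (circleMax (fun z => |u z|) r) ≤
            ε * (1 - r) ^ (-(Real.pi / (2 * Real.arctan (1 / c))))) ∧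
    (∀ γ : ℝ, 0 < γ → γ < 1 →
      ∃ k : ℝ, 0 < k ∧
        ∃ u : ℂ → ℝ, IsNonzeroHarmonicOnDisc u ∧ HasZeroLimitsAlong (fun t => t ^ γ) u ∧
          ∀ r ∈ Ioo (0 : ℝ) 1,
            Real.posLog (Real.posLog (circleMax (fun z => |u z|) r)) ≤
              k * (1 - r) ^ (γ - 1)) := by
  exact ⟨fun _ _ ho => exists_harmonic_of_littleO_cube ho,
    fun _ _ hγ _ hε => exists_harmonic_of_rpow_gt_one hγ hε,
    fun _ _ hc hε => exists_harmonic_of_sector hc hε,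
    fun _ hγ0 hγ1 => exists_harmonic_of_rpow_lt_one hγ0 hγ1⟩
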